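/- Let $\mathfrak P$ be a finite-dimensional projective space over a commutative field of characteristic $\neq 2$. Let $T$ and $B$ be disjoint projective subspaces of $\mathfrak P$, and let $Q$ be a nondegenerate quadric on $B$ that contains a projective line. Let $\nu=\dim Q=\dim B-1$ (projective dimensions), and assume $\nu\ge 3$. Let $S_0$ be the cone with vertex $T$ over $Q$, and let $S=S_0\setminus T$. * The *lines* are the nonempty sets $\ell\cap S$, where $\ell$ is a line of $\mathfrak P$ contained in $S_0$. The set $\mathcal G$ of *projective lines* consists of the lines of $\mathfrak P$ contained in $S_0$ that miss $T$. * The *star* $\mathbf s(a)$ is the set of all lines through $a\in S$. Two lines are *adjacent*, written $L\perp L'$, if $L\ne L'$ and they have a common point in $S$. * A *conic* is a section of $S$ by a plane of $\mathfrak P$ that has at least three points and contains no line. * A *projective cone* with vertex $a$ is a set $Z\subseteq S$ that is the union of the projective lines joining $a$ to the points of a conic whose plane does not contain $a$. Let $\mathfrak d^1_{1,0}$ be the set of all projective cones. * A *conic pencil* is a set of the form $\{L : a\in L\subseteq Z,\ L \text{ a line}\}$, where $Z$ is a projective cone with vertex $a$. Then: 1. $\{\mathbf s(a)\cap\mathcal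 G : a\in S\}=\bigl\{\{L\in\mathcal G:\ (\forall L'\in\mathcal G)\,[L'\subseteq Z\Rightarrow L\perp L'\ \vee\ L=L']\} : Z\in\mathfrak d^1_{1,0}\bigr\}$. 2. The point–line geometry $\langle S,\mathcal G,\in\rangle$ is definable in the structure $\mathscr C=\langle\mathcal G,\mathfrak d^1_{1,0},\subset\rangle$, and also in the structure $\langle\mathcal G,\{\text{conic pencils}\},\in\rangle$. That is, there are first-order formulas without parameters in the language of two-sorted incidence structures, namely a domain formula, an equality formula, and one formula for each of the relations "is a point", "is a line" and "is incident with", such that the following holds. In either structure, the elements satisfying the domain formula, taken modulo the equality formula, form together with the relations given by the remaining formulas a structure isomorphic to $\langle S,\mathcal G,\in\rangle$, and under this isomorphism every projective line represents itself. The formulas can be chosen to be the same for both structures and independent of the field, of $\mathfrak P$, $T$, $B$ and $Q$. -/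

import Mathlib

open scoped LinearAlgebra.Projectivization

universe u v

/-! ### Generalized Laguerre spaces -/

/-- The set of points of the projective subspace given by a linear subspace `W`. -/
def projPts {K : Type u} {V : Type v} [Field K] [AddCommGroup V] [Module K V]
    (W : Submodule K V) : Set (ℙ K V) :=
  {p | p.submodule ≤ W}

/-- The data defining a generalized Laguerre space in the projective space over `V`:
two transversal (i.e. disjoint) projective subspaces, the vertex `T` and `B`, together with
a nondegenerate ruled quadric on `B`, given by a quadratic form on `B`.
A quadric is ruled if it contains a projective line. -/
structure LaguerreSpace (K : Type u) (V : Type v) [Field K] [AddCommGroup V] [Module K V] where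
  T : Submodule K V
  B : Submodule K V
  transversal : Disjoint T B
  form : QuadraticForm K B
  nondegenerate : form.polarBilin.Nondegenerate
  ruled : ∃ W : Submodule K B, Module.finrank K W = 2 ∧ ∀ w ∈ W, form w = 0

namespace LaguerreSpace

variable {K : Type u} {V : Type v} [Field K] [AddCommGroup V] [Module K V]

/-- The quadric on `B`, as a set of points. -/
def quadric (𝔏 : LaguerreSpace K V) : Set (ℙ K V) :=
  {x | ∃ b : 𝔏.B, x.submodule = Submodule.span K {(b : V)} ∧ 𝔏.form b = 0}

/-- The dimension `ν` of the base, i.e. of the quadric. The projective dimension of the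
subspace `B` is `finrank K B - 1`, and the quadric is a hypersurface in it. -/
noncomputable def nu (𝔏 : LaguerreSpace K V) : ℕ :=
  Module.finrank K 𝔏.B - 2

/-- The projective cone with vertex `T` over the quadric. -/
def cone (𝔏 : LaguerreSpace K V) : Set (ℙ K V) :=
  {p | ∃ x ∈ 𝔏.quadric, p.submodule ≤ 𝔏.T ⊔ x.submodule}

/-- The point set `S` of the Laguerre space: the cone with its vertex deleted. -/
def S (𝔏 : LaguerreSpace K V) : Set (ℙ K V) :=
  𝔏.cone \ projPts 𝔏.T

/-- All lines: the nonempty sections with `S` of the projective lines lying on the cone. -/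
def lines (𝔏 : LaguerreSpace K V) : Set (Set (ℙ K V)) :=
  {X | ∃ W : Submodule K V, Module.finrank K W = 2 ∧ projPts W ⊆ 𝔏.cone ∧
    X = projPts W ∩ 𝔏.S ∧ X.Nonempty}

/-- The projective lines: the lines on the cone that miss the vertex `T`. -/
def projLines (𝔏 : LaguerreSpace K V) : Set (Set (ℙ K V)) :=
  {X | ∃ W : Submodule K V, Module.finrank K W = 2 ∧ projPts W ⊆ 𝔏.cone ∧
    Disjoint W 𝔏.T ∧ X = projPts W}

/-- The cycles (conics): the plane sections of `S` that are nontrivial (consist of more than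
two points) and contain no line. -/
def cycles (𝔏 : LaguerreSpace K V) : Set (Set (ℙ K V)) :=
  {C | ∃ A : Submodule K V, Module.finrank K A = 3 ∧ C = projPts A ∩ 𝔏.S ∧
    3 ≤ C.encard ∧ ∀ X ∈ 𝔏.lines, ¬ X ⊆ C}

/-- `Z` is a projective cone contained in `S`, with the point `a` as its vertex and a conic as
its base: the union of the projective lines joining `a` to the points of a cycle
whose plane does not contain `a`. -/
def IsProjConeAt (𝔏 : LaguerreSpace K V) (Z : Set (ℙ K V)) (a : ℙ K V) : Prop :=
  Z ⊆ 𝔏.S ∧ ∃ A : Submodule K V, Module.finrank K A = 3 ∧ projPts A ∩ 𝔏.S ∈ 𝔏.cycles ∧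
    a ∉ projPts A ∧
    Z = {p | ∃ c ∈ projPts A ∩ 𝔏.S, p.submodule ≤ a.submodule ⊔ c.submodule}

/-- The class `𝔡¹_{1,0}` of projective cones contained in `S`. -/
def projCones (𝔏 : LaguerreSpace K V) : Set (Set (ℙ K V)) :=
  {Z | ∃ a, 𝔏.IsProjConeAt Z a}

/-- The conic pencils: the lines contained in a projective cone and passing through its
vertex. -/
def conicPencils (𝔏 : LaguerreSpace K V) : Set (Set (Set (ℙ K V))) :=
  {p | ∃ Z a, 𝔏.IsProjConeAt Z a ∧ p = {L | L ∈ 𝔏.lines ∧ a ∈ L ∧ L ⊆ Z}}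

/-- The star of all lines through a point. -/
def star (𝔏 : LaguerreSpace K V) (a : ℙ K V) : Set (Set (ℙ K V)) :=
  {L | L ∈ 𝔏.lines ∧ a ∈ L}

/-- Two lines are adjacent if they are distinct and share a point of `S`. -/
def Adjacent (𝔏 : LaguerreSpace K V) (L₁ L₂ : Set (ℙ K V)) : Prop :=
  L₁ ≠ L₂ ∧ ∃ a ∈ 𝔏.S, a ∈ L₁ ∧ a ∈ L₂

end LaguerreSpace

/-! ### Two-sorted incidence structures and first-order definability -/

/-- Relation symbols for two-sorted incidence structures: two unary predicates for the sorts
and one binary relation between them. -/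
inductive IncRel : ℕ → Type
  | fst : IncRel 1
  | snd : IncRel 1
  | inc : IncRel 2

/-- The first-order language of two-sorted incidence structures. -/
def incLang : FirstOrder.Language where
  Functions := fun _ => Empty
  Relations := IncRel

/-- The universe of the two-sorted structure `⟨α, β, R⟩`. -/
structure IncStr {α β : Type v} (R : α → β → Prop) where
  val : α ⊕ β

instance {α β : Type v} (R : α → β → Prop) : incLang.Structure (IncStr R) where
  funMap := fun f _ => f.elim
  RelMap := fun r => match r with
    | .fst => fun xs => ∃ a, (xs 0).val = Sum.inl a
    | .snd => fun xs => ∃ b, (xs 0).val = Sum.inr b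
    | .inc => fun xs => ∃ a b, (xs 0).val = Sum.inl a ∧ (xs 1).val = Sum.inr b ∧ R a b

/-- Parameter-free first-order formulas that define, in a structure, another structure: a formula
for the domain, a formula for equality, and one formula for each relation symbol. -/
structure IncInterpretation where
  dom : incLang.Formula (Fin 1)
  eqv : incLang.Formula (Fin 2)
  rel : ∀ n : ℕ, IncRel n → incLang.Formula (Fin n)

/-- The formulas of `I`, evaluated in `M`, define `N` via the coordinate map `f`: the elements of
`N` are the elements of `M` satisfying the domain formula, taken up to the relation given by the
equality formula, and the relations of `N` are given by the corresponding formulas. -/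
def IncInterpretation.Defines (I : IncInterpretation) (M : Type*) (N : Type*)
    [incLang.Structure M] [incLang.Structure N]
    (f : {x : M // I.dom.Realize ![x]} → N) : Prop :=
  Function.Surjective f ∧
  (∀ x y : {x : M // I.dom.Realize ![x]}, I.eqv.Realize ![(x : M), (y : M)] ↔ f x = f y) ∧
  (∀ (n : ℕ) (r : IncRel n) (xs : Fin n → {x : M // I.dom.Realize ![x]}),
    (I.rel n r).Realize (fun i => (xs i : M)) ↔
      FirstOrder.Language.Structure.RelMap (L := incLang) r (fun i => f (xs i)))

namespace LaguerreSpace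

variable {K : Type u} {V : Type v} [Field K] [AddCommGroup V] [Module K V]

/-- The structure `⟨𝒢, 𝔡¹_{1,0}, ⊂⟩` of projective lines and projective cones. -/
abbrev ConeStructure (𝔏 : LaguerreSpace K V) : Type _ :=
  IncStr (fun (L : 𝔏.projLines) (Z : 𝔏.projCones) => (L : Set (ℙ K V)) ⊆ Z)

/-- The structure `⟨𝒢, conic pencils, ∈⟩`. -/
abbrev PencilStructure (𝔏 : LaguerreSpace K V) : Type _ :=
  IncStr (fun (L : 𝔏.projLines) (p : 𝔏.conicPencils) =>
    (L : Set (ℙ K V)) ∈ (p : Set (Set (ℙ K V))))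

/-- The point-line geometry `⟨S, 𝒢, ∈⟩`. -/
abbrev PointLineStructure (𝔏 : LaguerreSpace K V) : Type _ :=
  IncStr (fun (a : 𝔏.S) (L : 𝔏.projLines) => (a : ℙ K V) ∈ (L : Set (ℙ K V)))

end LaguerreSpace

/-! ### Quadratic forms with nondegenerate polar form -/

section QuadraticForm

open QuadraticMap

variable {K M : Type*} [Field K] [AddCommGroup M] [Module K M] {Q : QuadraticForm K M}

/-! Pull the form of `B` back along a projection that kills `T`. Points of `S` become singular
vectors of `T ⊔ B` outside `T`, and a projective line is spanned by two orthogonal singular vectors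
independent modulo `T` (`IsPair`). A projective cone amounts to a `Frame`: a vertex a and a plane
orthogonal to a on which the form is αβ + δγ² with δ ≠ 0. Orthogonal singular vectors of such a
plane are proportional, so distinct generators are never orthogonal.

Everything rests on `mem_of_meets`. If a projective line meets ⟨a, x⟩ in sa + tx and ⟨a, y⟩ in s'a +
t'y, these vectors are orthogonal, so tt'P(x, y) = 0; when P(x, y) ≠ 0, one of the two points is a.
Hence a projective line meeting two generators of a cone passes through its vertex. This gives the
first claim, once every point of `S` is known to be a vertex; here `B` must have rank at least 5, to
leave room for a nonsingular vector orthogonal to a and to a hyperbolic pair.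

For definability only the sets of generators matter, and cones and pencils yield the same ones
(`BlocksAreCones`). Lines in a common block meet, and nonorthogonal lines through a point share a
block. So a line sharing blocks with two members of p passes through the vertex of p (`NearBlock`),
and two such lines in one block q force q to have that vertex too (`InStarOf`). Every line through
the vertex is reached in this way, because a functional that is nonzero on the plane of a conic is
nonzero at two of its points (`exists_two_nonorthogonal`). Points are then blocks modulo equality of
stars. -/

/-- A nonzero vector has a partner with polar product one. -/
theorem QuadraticForm.exists_polar_eq_one (hQ : Q.polarBilin.Nondegenerate) {x : M} (hx : x ≠ 0) :
    ∃ y, polar Q x y = 1 := by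
  by_contra! h
  refine hx (hQ.1 x fun y => ?_)
  by_contra hy
  refine h ((polar Q x y)⁻¹ • y) ?_
  have hy' : polar Q x y ≠ 0 := hy
  rw [polar_smul_right, smul_eq_mul, inv_mul_cancel₀ hy']

/-- A vector orthogonal to one of two independent vectors but not to the other. -/
theorem QuadraticForm.exists_polar_eq_zero_one (hQ : Q.polarBilin.Nondegenerate) {b x : M}
    (hb : b ≠ 0) (hx : ∀ s : K, x ≠ s • b) : ∃ y, polar Q b y = 0 ∧ polar Q x y = 1 := by
  obtain ⟨v, hv⟩ := QuadraticForm.exists_polar_eq_one hQ hb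
  -- The vector x - polar(x, v) b is orthogonal to v, so y may be corrected by a multiple of v
  -- without changing its product with that vector.
  obtain ⟨y, hy⟩ := QuadraticForm.exists_polar_eq_one hQ
    (sub_ne_zero.2 (hx (polar Q x v)))
  refine ⟨y - polar Q b y • v, ?_, ?_⟩
  · simp [polar_sub_right, polar_smul_right, hv]
  · rw [polar_sub_left, polar_smul_left, smul_eq_mul] at hy
    rw [polar_sub_right, polar_smul_right, smul_eq_mul, mul_comm, hy]

/-- A singular vector orthogonal to a given one has a singular partner that is also orthogonal
to the given one. -/
theorem QuadraticForm.exists_hyperbolic_partner (hQ : Q.polarBilin.Nondegenerate) {b x : M}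
    (hb : b ≠ 0) (hx : ∀ s : K, x ≠ s • b) (hQx : Q x = 0) (hbx : polar Q b x = 0) :
    ∃ y, Q y = 0 ∧ polar Q b y = 0 ∧ polar Q x y = 1 := by
  obtain ⟨y, hby, hxy⟩ := QuadraticForm.exists_polar_eq_zero_one hQ hb hx
  have hxx : polar Q x x = 0 := by rw [polar_self, hQx, smul_zero]
  -- As polar(x, y) = 1 and x is singular, subtracting Q(y) x lowers the value of y by exactly Q(y).
  refine ⟨y - Q y • x, ?_, ?_, ?_⟩
  · rw [sub_eq_add_neg, QuadraticMap.map_add (⇑Q), QuadraticMap.map_neg, QuadraticMap.map_smul,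
      polar_neg_right, polar_smul_right, polar_comm Q y x, hxy, hQx]
    simp
  · simp [polar_sub_right, polar_smul_right, hby, hbx]
  · simp [polar_sub_right, polar_smul_right, hxy, hxx]

/-- A singular vector orthogonal to a given one, if there is a totally singular plane. -/
theorem QuadraticForm.exists_singular_orthogonal (W : Submodule K M) (hW : Module.finrank K W = 2)
    (hQW : ∀ w ∈ W, Q w = 0) (b : M) :
    ∃ x, Q x = 0 ∧ polar Q b x = 0 ∧ ∀ s : K, x ≠ s • b := by
  have : FiniteDimensional K W := Module.finite_of_finrank_eq_succ hW
  by_cases hb : b ∈ W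
  · have h : ∃ x ∈ W, x ∉ Submodule.span K {b} := by
      by_contra! h
      have h1 := Submodule.finrank_mono (R := K) (s := W) (t := Submodule.span K {b}) h
      have h2 := finrank_span_le_card (R := K) ({b} : Set M)
      rw [Set.toFinset_singleton, Finset.card_singleton] at h2
      omega
    obtain ⟨x, hxW, hx⟩ := h
    refine ⟨x, hQW x hxW, ?_, fun s hs => hx (hs ▸ Submodule.smul_mem _ _ (Submodule.mem_span_singleton_self b))⟩
    rw [polar, hQW _ (W.add_mem hb hxW), hQW _ hb, hQW _ hxW]; simp
  · have h : LinearMap.ker ((Q.polarBilin b).comp W.subtype) ≠ ⊥ :=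
      LinearMap.ker_ne_bot_of_finrank_lt (by rw [hW, Module.finrank_self]; norm_num)
    obtain ⟨x, hx, hx0⟩ := Submodule.exists_mem_ne_zero_of_ne_bot h
    refine ⟨x, hQW _ x.2, by simpa using hx, fun s hs => ?_⟩
    have hs0 : s ≠ 0 := by
      rintro rfl
      exact hx0 (Subtype.ext (by simpa using hs))
    refine hb ?_
    rw [← inv_smul_smul₀ hs0 b, ← hs]
    exact W.smul_mem _ x.2

/-- In dimension at least five, a hyperbolic pair orthogonal to a vector is completed by a
nonsingular vector orthogonal to all of them. -/
theorem QuadraticForm.exists_nonsingular_orthogonal [FiniteDimensional K M]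
    (hQ : Q.polarBilin.Nondegenerate) (hM : 5 ≤ Module.finrank K M) {b x y : M} (hb : b ≠ 0)
    (hQx : Q x = 0) (hQy : Q y = 0) (hxy : polar Q x y = 1)
    (hbx : polar Q b x = 0) (hby : polar Q b y = 0) :
    ∃ z, Q z ≠ 0 ∧ polar Q b z = 0 ∧ polar Q x z = 0 ∧ polar Q y z = 0 := by
  have hxx : polar Q x x = 0 := by rw [polar_self, hQx, smul_zero]
  have hyy : polar Q y y = 0 := by rw [polar_self, hQy, smul_zero]
  have hyx : polar Q y x = 1 := by rw [polar_comm, hxy]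
  -- m' is the component of m orthogonal to the hyperbolic plane ⟨x, y⟩.
  have key : ∀ m : M, ∃ m' : M, polar Q x m' = 0 ∧ polar Q y m' = 0 ∧
      ∀ n, polar Q n x = 0 → polar Q n y = 0 → polar Q n m' = polar Q n m := fun m => by
    refine ⟨m - polar Q y m • x - polar Q x m • y, ?_, ?_, fun n h1 h2 => ?_⟩ <;>
      simp [polar_sub_right, polar_smul_right, *]
  obtain ⟨b₀, hb₀⟩ := QuadraticForm.exists_polar_eq_one hQ hb
  obtain ⟨b', hxb', hyb', hb'⟩ := key b₀
  replace hb' : polar Q b b' = 1 := (hb' b hbx hby).trans hb₀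
  -- Four conditions leave a nonzero m in rank at least five. Orthogonality to b' lets n below be
  -- made orthogonal to b without altering its product with m.
  let f : M →ₗ[K] (Fin 4 → K) := LinearMap.pi ![Q.polarBilin x, Q.polarBilin y, Q.polarBilin b,
    Q.polarBilin b']
  have hf : LinearMap.ker f ≠ ⊥ :=
    LinearMap.ker_ne_bot_of_finrank_lt (by simp only [Module.finrank_fin_fun]; omega)
  obtain ⟨m, hm, hm0⟩ := Submodule.exists_mem_ne_zero_of_ne_bot hf
  rw [LinearMap.mem_ker, funext_iff] at hm
  have hxm : polar Q x m = 0 := hm 0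
  have hym : polar Q y m = 0 := hm 1
  have hbm : polar Q b m = 0 := hm 2
  have hb'm : polar Q b' m = 0 := hm 3
  by_cases hQm : Q m = 0
  swap
  · exact ⟨m, hQm, hbm, hxm, hym⟩
  obtain ⟨n₀, hn₀⟩ := QuadraticForm.exists_polar_eq_one hQ hm0
  obtain ⟨n₁, hxn₁, hyn₁, hn₁⟩ := key n₀
  have hmn₁ : polar Q m n₁ = 1 := by
    rw [hn₁ m (by rw [polar_comm, hxm]) (by rw [polar_comm, hym]), hn₀]
  obtain ⟨n, hxn, hyn, hbn, hmn⟩ : ∃ n, polar Q x n = 0 ∧ polar Q y n = 0 ∧ polar Q b n = 0 ∧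
      polar Q m n = 1 := by
    refine ⟨n₁ - polar Q b n₁ • b', ?_, ?_, ?_, ?_⟩ <;>
      simp [polar_sub_right, polar_smul_right, polar_comm Q m b', *]
  by_cases hQn : Q n = 0
  · refine ⟨m + n, ?_, ?_, ?_, ?_⟩
    · rw [QuadraticMap.map_add (⇑Q), hQm, hQn, hmn]; simp
    all_goals simp [polar_add_right, *]
  · exact ⟨n, hQn, hbn, hxn, hyn⟩

end QuadraticForm

/-! ### The ambient quadratic form -/

/-! ### Linear subspaces and their sets of points -/

section ProjPts

variable {K : Type u} {V : Type v} [Field K] [AddCommGroup V] [Module K V]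

theorem mk_mem_projPts {W : Submodule K V} {x : V} (hx : x ≠ 0) :
    Projectivization.mk K x hx ∈ projPts W ↔ x ∈ W := by
  simp [projPts]

theorem projPts_subset_iff {W W' : Submodule K V} : projPts W ⊆ projPts W' ↔ W ≤ W' := by
  refine ⟨fun h x hx => ?_, fun h p hp => le_trans (show p.submodule ≤ W from hp) h⟩
  by_cases hx0 : x = 0
  · simp [hx0]
  · exact (mk_mem_projPts hx0).1 (h ((mk_mem_projPts hx0).2 hx))

theorem projPts_injective : Function.Injective (projPts (K := K) (V := V)) := fun _ _ h =>
  le_antisymm (projPts_subset_iff.1 h.le) (projPts_subset_iff.1 h.ge)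

theorem span_pair_eq_of_mem {a x y : V} (hx : x ∈ Submodule.span K {a, y})
    (h : ∀ s : K, x ≠ s • a) : Submodule.span K {a, x} = Submodule.span K {a, y} := by
  obtain ⟨s, t, rfl⟩ := Submodule.mem_span_pair.1 hx
  have ht : t ≠ 0 := fun ht => h s (by simp [ht])
  apply le_antisymm <;> rw [Submodule.span_le, Set.pair_subset_iff]
  · exact ⟨Submodule.subset_span (by simp), hx⟩
  · refine ⟨Submodule.subset_span (by simp), Submodule.mem_span_pair.2 ⟨-(t⁻¹ * s), t⁻¹, ?_⟩⟩
    rw [smul_add, smul_smul, smul_smul, inv_mul_cancel₀ ht]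
    module

end ProjPts

/-! ### The pulled-back form and its singular vectors -/

namespace LaguerreSpace

variable {K : Type u} {V : Type v} [Field K] [AddCommGroup V] [Module K V] (𝔏 : LaguerreSpace K V)

/-- `T ⊔ B` need not be all of `V`, so `T` is first enlarged to a complement of `B`. Outside `T ⊔ B`
the projection depends on this choice, which is why `Sing` also requires membership in `T ⊔ B`. -/
theorem exists_proj : ∃ π : V →ₗ[K] 𝔏.B, (∀ b : 𝔏.B, π b = b) ∧ ∀ t ∈ 𝔏.T, π t = 0 := by
  obtain ⟨T', hT, hc⟩ := 𝔏.transversal.exists_isCompl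
  refine ⟨Submodule.projectionOnto 𝔏.B T' hc.symm, fun b => ?_, fun t ht => ?_⟩
  · simp
  · simpa using hT ht

/-- A projection onto the base that annihilates the vertex. -/
noncomputable def proj : V →ₗ[K] 𝔏.B := 𝔏.exists_proj.choose

theorem proj_base (b : 𝔏.B) : 𝔏.proj b = b := 𝔏.exists_proj.choose_spec.1 b

theorem proj_vertex {t : V} (ht : t ∈ 𝔏.T) : 𝔏.proj t = 0 := 𝔏.exists_proj.choose_spec.2 t ht

/-- The form of the base, pulled back to the ambient space. -/
noncomputable def Q : QuadraticForm K V := 𝔏.form.comp 𝔏.proj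

/-- The polar form of the ambient quadratic form. -/
noncomputable def P : LinearMap.BilinForm K V := 𝔏.Q.polarBilin

/-- The singular vectors: those spanning the points of the cone. -/
def Sing (x : V) : Prop := x ∈ 𝔏.T ⊔ 𝔏.B ∧ 𝔏.Q x = 0

theorem Q_apply (x : V) : 𝔏.Q x = 𝔏.form (𝔏.proj x) := rfl

theorem P_apply (x y : V) : 𝔏.P x y = QuadraticMap.polar 𝔏.form (𝔏.proj x) (𝔏.proj y) := by
  change QuadraticMap.polar 𝔏.Q x y = _
  simp [QuadraticMap.polar, Q_apply]

theorem Q_add (x y : V) : 𝔏.Q (x + y) = 𝔏.Q x + 𝔏.Q y + 𝔏.P x y :=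
  QuadraticMap.map_add 𝔏.Q x y

theorem Q_smul (s : K) (x : V) : 𝔏.Q (s • x) = s * s * 𝔏.Q x := QuadraticMap.map_smul 𝔏.Q s x

theorem P_comm (x y : V) : 𝔏.P x y = 𝔏.P y x := QuadraticMap.polar_comm 𝔏.Q x y

theorem P_self (x : V) : 𝔏.P x x = 2 * 𝔏.Q x := by
  have : 𝔏.P x x = 2 • 𝔏.Q x := QuadraticMap.polar_self 𝔏.Q x
  rw [this, two_nsmul, two_mul]

/-- The kernel of `proj` lies in the radical. Independence modulo `T` is therefore tested by pairing
with suitable vectors. -/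
theorem P_eq_zero {x : V} (hx : 𝔏.proj x = 0) (y : V) : 𝔏.P x y = 0 := by
  rw [P_apply, hx, QuadraticMap.polar_zero_left]

theorem mem_vertex_of_proj_eq_zero {x : V} (hx : x ∈ 𝔏.T ⊔ 𝔏.B) (h : 𝔏.proj x = 0) : x ∈ 𝔏.T := by
  obtain ⟨t, ht, b, hb, rfl⟩ := Submodule.mem_sup.1 hx
  rw [map_add, 𝔏.proj_vertex ht, zero_add, 𝔏.proj_base ⟨b, hb⟩] at h
  rw [show b = 0 from congrArg Subtype.val h, add_zero]
  exact ht

theorem sub_proj_mem {x : V} (hx : x ∈ 𝔏.T ⊔ 𝔏.B) : x - 𝔏.proj x ∈ 𝔏.T := by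
  refine 𝔏.mem_vertex_of_proj_eq_zero (Submodule.sub_mem _ hx ?_) ?_
  · exact Submodule.mem_sup_right (𝔏.proj x).2
  · rw [map_sub, proj_base, sub_self]

variable {𝔏}

theorem Sing.combination {x y : V} (hx : 𝔏.Sing x) (hy : 𝔏.Sing y) (hxy : 𝔏.P x y = 0) (s t : K) :
    𝔏.Sing (s • x + t • y) := by
  refine ⟨Submodule.add_mem _ (Submodule.smul_mem _ _ hx.1) (Submodule.smul_mem _ _ hy.1), ?_⟩
  simp [Q_add, Q_smul, hx.2, hy.2, hxy]

variable (𝔏)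

theorem exists_mem_quadric : ∃ x, x ∈ 𝔏.quadric := by
  obtain ⟨W, hW, h⟩ := 𝔏.ruled
  have : W ≠ ⊥ := by
    rintro rfl
    simp at hW
  obtain ⟨b, hb, hb0⟩ := Submodule.exists_mem_ne_zero_of_ne_bot this
  exact ⟨Projectivization.mk K (b : V) (by simpa using hb0), b, by simp, h b hb⟩

theorem mk_mem_cone {x : V} (hx : x ≠ 0) : Projectivization.mk K x hx ∈ 𝔏.cone ↔ 𝔏.Sing x := by
  constructor
  · rintro ⟨p, ⟨b, hp, hb⟩, h⟩
    rw [hp, Projectivization.submodule_mk, Submodule.span_singleton_le_iff_mem] at h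
    obtain ⟨t, ht, b', hb', rfl⟩ := Submodule.mem_sup.1 h
    obtain ⟨s, rfl⟩ := Submodule.mem_span_singleton.1 hb'
    refine ⟨Submodule.add_mem _ (Submodule.mem_sup_left ht)
      (Submodule.mem_sup_right (𝔏.B.smul_mem _ b.2)), ?_⟩
    rw [Q_apply, map_add, map_smul, proj_base, 𝔏.proj_vertex ht, zero_add, QuadraticMap.map_smul,
      hb, smul_zero]
  · rintro ⟨hU, hQ⟩
    by_cases h : 𝔏.proj x = 0
    -- A point of `T` lies under every point of the quadric; it suffices that the quadric is
    -- nonempty.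
    · obtain ⟨p, hp⟩ := 𝔏.exists_mem_quadric
      refine ⟨p, hp, ?_⟩
      rw [Projectivization.submodule_mk, Submodule.span_singleton_le_iff_mem]
      exact Submodule.mem_sup_left (𝔏.mem_vertex_of_proj_eq_zero hU h)
    · refine ⟨Projectivization.mk K (𝔏.proj x : V) (by simpa using h), ⟨𝔏.proj x, by simp, hQ⟩, ?_⟩
      rw [Projectivization.submodule_mk, Projectivization.submodule_mk,
        Submodule.span_singleton_le_iff_mem]
      exact Submodule.mem_sup.2 ⟨_, 𝔏.sub_proj_mem hU, _, Submodule.mem_span_singleton_self _,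
        sub_add_cancel _ _⟩

theorem mk_mem_S {x : V} (hx : x ≠ 0) :
    Projectivization.mk K x hx ∈ 𝔏.S ↔ 𝔏.Sing x ∧ 𝔏.proj x ≠ 0 := by
  rw [S, Set.mem_sdiff, mk_mem_cone, mk_mem_projPts]
  exact and_congr_right fun h => not_congr
    ⟨𝔏.proj_vertex, 𝔏.mem_vertex_of_proj_eq_zero h.1⟩

theorem projPts_subset_cone {W : Submodule K V} : projPts W ⊆ 𝔏.cone ↔ ∀ x ∈ W, 𝔏.Sing x := by
  constructor
  · intro h x hx
    by_cases hx0 : x = 0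
    · rw [hx0]
      exact ⟨Submodule.zero_mem _, map_zero _⟩
    · exact (𝔏.mk_mem_cone hx0).1 (h ((mk_mem_projPts hx0).2 hx))
  · intro h p
    induction p using Projectivization.ind with
    | h x hx => exact fun hp => (𝔏.mk_mem_cone hx).2 (h x ((mk_mem_projPts hx).1 hp))

/-! ### Projective lines -/

/-- Two orthogonal singular vectors that are independent modulo the vertex. -/
structure IsPair (a x : V) : Prop where
  sing_left : 𝔏.Sing a
  sing_right : 𝔏.Sing x
  ortho : 𝔏.P a x = 0
  indep : ∀ s t : K, 𝔏.proj (s • a + t • x) = 0 → s = 0 ∧ t = 0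

variable {𝔏}

theorem IsPair.proj_left_ne_zero {a x : V} (h : 𝔏.IsPair a x) : 𝔏.proj a ≠ 0 := fun h0 =>
  one_ne_zero (h.indep 1 0 (by simp [h0])).1

theorem IsPair.proj_right_ne_zero {a x : V} (h : 𝔏.IsPair a x) : 𝔏.proj x ≠ 0 := fun h0 =>
  one_ne_zero (h.indep 0 1 (by simp [h0])).2

theorem IsPair.right_ne_zero {a x : V} (h : 𝔏.IsPair a x) : x ≠ 0 := fun h0 =>
  h.proj_right_ne_zero (by simp [h0])

theorem IsPair.ne_smul {a x : V} (h : 𝔏.IsPair a x) (s : K) : x ≠ s • a := fun h0 =>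
  one_ne_zero (h.indep (-s) 1 (by simp [h0])).2

theorem projPts_mem_projLines {W : Submodule K V} : projPts W ∈ 𝔏.projLines ↔
    Module.finrank K W = 2 ∧ ∀ x ∈ W, 𝔏.Sing x ∧ (𝔏.proj x = 0 → x = 0) := by
  constructor
  · rintro ⟨W', h1, h2, h3, h4⟩
    obtain rfl := projPts_injective h4
    rw [projPts_subset_cone] at h2
    exact ⟨h1, fun x hx => ⟨h2 x hx, fun h0 => Submodule.disjoint_def.1 h3 x hx
      (𝔏.mem_vertex_of_proj_eq_zero (h2 x hx).1 h0)⟩⟩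
  · rintro ⟨h1, h2⟩
    exact ⟨W, h1, 𝔏.projPts_subset_cone.2 fun x hx => (h2 x hx).1,
      Submodule.disjoint_def.2 fun x hx hT => (h2 x hx).2 (𝔏.proj_vertex hT), rfl⟩

theorem exists_submodule_of_mem_projLines {L : Set (ℙ K V)} (hL : L ∈ 𝔏.projLines) :
    ∃ W : Submodule K V, L = projPts W :=
  let ⟨W, _, _, _, h⟩ := hL
  ⟨W, h⟩

theorem IsPair.projPts_mem {a x : V} (h : 𝔏.IsPair a x) :
    projPts (Submodule.span K {a, x}) ∈ 𝔏.projLines := by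
  refine projPts_mem_projLines.2 ⟨?_, fun z hz => ?_⟩
  · have := finrank_span_eq_card (R := K) (LinearIndependent.pair_iff.2 fun s t hst =>
      h.indep s t (by rw [hst, map_zero]))
    rwa [Matrix.range_cons, Matrix.range_cons, Matrix.range_empty, Set.union_empty,
      Set.singleton_union, Fintype.card_fin] at this
  · obtain ⟨s, t, rfl⟩ := Submodule.mem_span_pair.1 hz
    refine ⟨h.sing_left.combination h.sing_right h.ortho s t, fun h0 => ?_⟩
    obtain ⟨rfl, rfl⟩ := h.indep s t h0
    simp

theorem exists_isPair {W : Submodule K V} (hW : projPts W ∈ 𝔏.projLines) {a : V} (ha : a ≠ 0)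
    (haW : a ∈ W) : ∃ x, 𝔏.IsPair a x ∧ W = Submodule.span K {a, x} := by
  obtain ⟨h1, h2⟩ := projPts_mem_projLines.1 hW
  have : FiniteDimensional K W := Module.finite_of_finrank_eq_succ h1
  have h : ∃ x ∈ W, x ∉ Submodule.span K {a} := by
    by_contra! h
    have h3 := Submodule.finrank_mono (R := K) (s := W) (t := Submodule.span K {a}) h
    have h4 := finrank_span_le_card (R := K) ({a} : Set V)
    rw [Set.toFinset_singleton, Finset.card_singleton] at h4
    omega
  obtain ⟨x, hxW, hx⟩ := h
  have hp : 𝔏.IsPair a x := by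
    refine ⟨(h2 a haW).1, (h2 x hxW).1, ?_, fun s t hst => ?_⟩
    · have := 𝔏.Q_add a x
      rw [(h2 _ (W.add_mem haW hxW)).1.2, (h2 a haW).1.2, (h2 x hxW).1.2] at this
      simpa using this.symm
    · have h0 := (h2 _ (W.add_mem (W.smul_mem s haW) (W.smul_mem t hxW))).2 hst
      have ht : t = 0 := by
        by_contra ht
        refine hx (Submodule.mem_span_singleton.2 ⟨-(t⁻¹ * s), ?_⟩)
        have := congrArg (t⁻¹ • ·) (eq_neg_of_add_eq_zero_right h0)
        simp only [smul_smul, inv_mul_cancel₀ ht, one_smul, smul_neg] at this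
        rw [this, neg_smul]
      subst ht
      simpa [ha] using h0
  refine ⟨x, hp, (Submodule.eq_of_le_of_finrank_eq ?_ ?_).symm⟩
  · rw [Submodule.span_le, Set.pair_subset_iff]
    exact ⟨haW, hxW⟩
  · rw [(projPts_mem_projLines.1 hp.projPts_mem).1, h1]

theorem ne_zero_of_proj_ne_zero {a : V} (h : 𝔏.proj a ≠ 0) : a ≠ 0 := fun h0 => h (by simp [h0])

theorem exists_isPair_of_mem {L : Set (ℙ K V)} (hL : L ∈ 𝔏.projLines) {a : V} (ha : a ≠ 0)
    (haL : Projectivization.mk K a ha ∈ L) :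
    ∃ x, 𝔏.IsPair a x ∧ L = projPts (Submodule.span K {a, x}) := by
  obtain ⟨W, rfl⟩ := exists_submodule_of_mem_projLines hL
  obtain ⟨x, hx, rfl⟩ := exists_isPair hL ha ((mk_mem_projPts ha).1 haL)
  exact ⟨x, hx, rfl⟩

theorem projLines_subset_S {L : Set (ℙ K V)} (hL : L ∈ 𝔏.projLines) : L ⊆ 𝔏.S := by
  obtain ⟨W, rfl⟩ := exists_submodule_of_mem_projLines hL
  intro p
  induction p using Projectivization.ind with
  | h x hx =>
    intro hp
    have := (projPts_mem_projLines.1 hL).2 x ((mk_mem_projPts hx).1 hp)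
    exact (𝔏.mk_mem_S hx).2 ⟨this.1, fun h => hx (this.2 h)⟩

theorem exists_mem_of_mem_projLines {L : Set (ℙ K V)} (hL : L ∈ 𝔏.projLines) : ∃ p, p ∈ L := by
  obtain ⟨W, rfl⟩ := exists_submodule_of_mem_projLines hL
  have : W ≠ ⊥ := by
    rintro rfl
    simpa using (projPts_mem_projLines.1 hL).1
  obtain ⟨b, hb, hb0⟩ := Submodule.exists_mem_ne_zero_of_ne_bot this
  exact ⟨Projectivization.mk K b hb0, (mk_mem_projPts hb0).2 hb⟩

theorem projLines_subset_lines : 𝔏.projLines ⊆ 𝔏.lines := by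
  intro L hL
  obtain ⟨W, rfl⟩ := exists_submodule_of_mem_projLines hL
  have h := Set.inter_eq_left.2 (projLines_subset_S hL)
  obtain ⟨h1, h2⟩ := projPts_mem_projLines.1 hL
  exact ⟨W, h1, 𝔏.projPts_subset_cone.2 fun x hx => (h2 x hx).1, h.symm,
    exists_mem_of_mem_projLines hL⟩

/-- Two distinct projective lines have at most one common point. -/
theorem eq_of_mem_of_mem {L M : Set (ℙ K V)} (hL : L ∈ 𝔏.projLines) (hM : M ∈ 𝔏.projLines)
    (hLM : L ≠ M) {p q : ℙ K V} (hpL : p ∈ L) (hpM : p ∈ M) (hqL : q ∈ L) (hqM : q ∈ M) :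
    p = q := by
  induction p using Projectivization.ind with
  | h a ha =>
  induction q using Projectivization.ind with
  | h b hb =>
  obtain ⟨x, hx, rfl⟩ := exists_isPair_of_mem hL ha hpL
  obtain ⟨y, hy, rfl⟩ := exists_isPair_of_mem hM ha hpM
  by_contra hab
  have hab' : ∀ s : K, b ≠ s • a := fun s hs =>
    hab ((Projectivization.mk_eq_mk_iff' K _ _ hb ha).2 ⟨s, hs.symm⟩).symm
  rw [mk_mem_projPts] at hqL hqM
  exact hLM (by rw [← span_pair_eq_of_mem hqL hab', ← span_pair_eq_of_mem hqM hab'])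

/-- A projective line that meets two nonorthogonal lines through a point passes through this
point. -/
theorem mem_of_meets {a x y : V} (ha : a ≠ 0) (hx : 𝔏.IsPair a x) (hy : 𝔏.IsPair a y)
    (hxy : 𝔏.P x y ≠ 0) {M : Set (ℙ K V)} (hM : M ∈ 𝔏.projLines) {p q : ℙ K V}
    (hp : p ∈ projPts (Submodule.span K {a, x})) (hpM : p ∈ M)
    (hq : q ∈ projPts (Submodule.span K {a, y})) (hqM : q ∈ M) :
    Projectivization.mk K a ha ∈ M := by
  obtain ⟨W, rfl⟩ := exists_submodule_of_mem_projLines hM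
  induction p using Projectivization.ind with
  | h v hv =>
  induction q using Projectivization.ind with
  | h w hw =>
  rw [mk_mem_projPts] at *
  have h := (projPts_mem_projLines.1 hM).2
  have hvw : 𝔏.P v w = 0 := by
    have := 𝔏.Q_add v w
    rw [(h _ (W.add_mem hpM hqM)).1.2, (h v hpM).1.2, (h w hqM).1.2] at this
    simpa using this.symm
  obtain ⟨s, t, rfl⟩ := Submodule.mem_span_pair.1 hp
  obtain ⟨s', t', rfl⟩ := Submodule.mem_span_pair.1 hq
  have haa : 𝔏.P a a = 0 := by rw [P_self, hx.sing_left.2, mul_zero]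
  -- All products involving a vanish, so `hvw` becomes the vanishing of t * t' * P x y.
  simp only [map_add, map_smul, LinearMap.add_apply, LinearMap.smul_apply, smul_eq_mul,
    𝔏.P_comm x a, hx.ortho, hy.ortho, haa, mul_zero, zero_add, mul_eq_zero, hxy, or_false] at hvw
  rcases hvw with rfl | rfl
  · rw [zero_smul, add_zero] at hqM hw
    exact (W.smul_mem_iff (left_ne_zero_of_smul hw)).1 hqM
  · rw [zero_smul, add_zero] at hpM hv
    exact (W.smul_mem_iff (left_ne_zero_of_smul hv)).1 hpM

end LaguerreSpace

namespace LaguerreSpace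

variable {K : Type u} {V : Type v} [Field K] [AddCommGroup V] [Module K V] (𝔏 : LaguerreSpace K V)

/-! ### Frames of projective cones -/

/-- A vertex together with a basis of the plane of a conic, consisting of a hyperbolic pair and
a nonsingular vector orthogonal to it. -/
structure Frame where
  a : V
  c₁ : V
  c₂ : V
  y : V
  proj_a : 𝔏.proj a ≠ 0
  sing_a : 𝔏.Sing a
  sing_c₁ : 𝔏.Sing c₁
  sing_c₂ : 𝔏.Sing c₂
  mem_y : y ∈ 𝔏.T ⊔ 𝔏.B
  Q_y : 𝔏.Q y ≠ 0
  P_c₁_c₂ : 𝔏.P c₁ c₂ = 1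
  P_c₁_y : 𝔏.P c₁ y = 0
  P_c₂_y : 𝔏.P c₂ y = 0
  P_a_c₁ : 𝔏.P a c₁ = 0
  P_a_c₂ : 𝔏.P a c₂ = 0
  P_a_y : 𝔏.P a y = 0

variable {𝔏}

theorem Sing.P_self {x : V} (hx : 𝔏.Sing x) : 𝔏.P x x = 0 := by
  rw [LaguerreSpace.P_self, hx.2, mul_zero]

namespace Frame

variable (F : 𝔏.Frame)

/-- The plane of the conic. -/
def plane : Submodule K V := Submodule.span K {F.c₁, F.c₂, F.y}

theorem a_ne_zero : F.a ≠ 0 := ne_zero_of_proj_ne_zero F.proj_a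

/-- The vertex of the cone. -/
def vertex : ℙ K V := Projectivization.mk K F.a F.a_ne_zero

/-- The cone. -/
def cone : Set (ℙ K V) :=
  {p | ∃ c ∈ projPts F.plane ∩ 𝔏.S, p.submodule ≤ F.vertex.submodule ⊔ c.submodule}

/-- The generators of the cone. -/
def IsGen (L : Set (ℙ K V)) : Prop :=
  ∃ c ∈ F.plane, c ≠ 0 ∧ 𝔏.Q c = 0 ∧ L = projPts (Submodule.span K {F.a, c})

theorem P_c₁_c₁ : 𝔏.P F.c₁ F.c₁ = 0 := F.sing_c₁.P_self

theorem P_c₂_c₂ : 𝔏.P F.c₂ F.c₂ = 0 := F.sing_c₂.P_self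

theorem P_c₂_c₁ : 𝔏.P F.c₂ F.c₁ = 1 := by rw [P_comm, F.P_c₁_c₂]

theorem P_y_c₁ : 𝔏.P F.y F.c₁ = 0 := by rw [P_comm, F.P_c₁_y]

theorem P_y_c₂ : 𝔏.P F.y F.c₂ = 0 := by rw [P_comm, F.P_c₂_y]

theorem P_y_y : 𝔏.P F.y F.y = 2 * 𝔏.Q F.y := P_self 𝔏 _

theorem mem_plane {c : V} : c ∈ F.plane ↔ ∃ α β γ : K, α • F.c₁ + β • F.c₂ + γ • F.y = c :=
  Submodule.mem_span_triple

theorem P_comb (α β γ α' β' γ' : K) :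
    𝔏.P (α • F.c₁ + β • F.c₂ + γ • F.y) (α' • F.c₁ + β' • F.c₂ + γ' • F.y) =
      α * β' + β * α' + 2 * (γ * γ' * 𝔏.Q F.y) := by
  simp only [map_add, map_smul, LinearMap.add_apply, LinearMap.smul_apply, smul_eq_mul, P_c₁_c₁,
    P_c₂_c₂, P_c₂_c₁, P_c₁_c₂, P_y_c₁, P_y_c₂, P_c₁_y, P_c₂_y, P_y_y]
  ring

theorem Q_comb (α β γ : K) :
    𝔏.Q (α • F.c₁ + β • F.c₂ + γ • F.y) = α * β + γ * γ * 𝔏.Q F.y := by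
  simp only [Q_add, Q_smul, map_add, map_smul, LinearMap.add_apply, LinearMap.smul_apply,
    smul_eq_mul, P_c₁_c₂, P_c₁_y, P_c₂_y, F.sing_c₁.2, F.sing_c₂.2]
  ring

theorem c₁_mem : F.c₁ ∈ F.plane := Submodule.subset_span (by simp)

theorem c₂_mem : F.c₂ ∈ F.plane := Submodule.subset_span (by simp)

theorem y_mem : F.y ∈ F.plane := Submodule.subset_span (by simp)

theorem plane_le : F.plane ≤ 𝔏.T ⊔ 𝔏.B := by
  rw [plane, Submodule.span_le]
  rintro _ (rfl | rfl | rfl)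
  exacts [F.sing_c₁.1, F.sing_c₂.1, F.mem_y]

theorem P_a_plane {c : V} (hc : c ∈ F.plane) : 𝔏.P F.a c = 0 := by
  obtain ⟨α, β, γ, rfl⟩ := F.mem_plane.1 hc
  simp [F.P_a_c₁, F.P_a_c₂, F.P_a_y]

/-- The polar form of αβ + δγ² is nondegenerate away from characteristic 2: pairing with y gives
2γδ. -/
theorem eq_zero_of_ortho (h2 : (2 : K) ≠ 0) {c : V} (hc : c ∈ F.plane) (h : ∀ z ∈ F.plane, 𝔏.P c z = 0) :
    c = 0 := by
  have h₁ := h _ F.c₁_mem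
  have h₂ := h _ F.c₂_mem
  have h₃ := h _ F.y_mem
  obtain ⟨α, β, γ, rfl⟩ := F.mem_plane.1 hc
  simp only [map_add, map_smul, LinearMap.add_apply, LinearMap.smul_apply, smul_eq_mul, P_c₁_c₁,
    P_c₂_c₂, P_c₂_c₁, P_c₁_c₂, P_y_c₁, P_y_c₂, P_c₁_y, P_c₂_y, P_y_y] at h₁ h₂ h₃
  have hβ : β = 0 := by simpa using h₁
  have hα : α = 0 := by simpa using h₂
  have hγ : γ = 0 := by simpa [h2, F.Q_y] using h₃
  simp [hα, hβ, hγ]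

/-- A combination of a and c killed by `proj` is orthogonal to everything. Since a is orthogonal to
the plane, nondegeneracy of the plane kills the coefficient of c. -/
theorem isPair (h2 : (2 : K) ≠ 0) {c : V} (hc : c ∈ F.plane) (hc0 : c ≠ 0) (hQ : 𝔏.Q c = 0) :
    𝔏.IsPair F.a c := by
  refine ⟨F.sing_a, ⟨F.plane_le hc, hQ⟩, F.P_a_plane hc, fun s t h => ?_⟩
  have ht : t = 0 := by
    by_contra ht
    refine hc0 (F.eq_zero_of_ortho h2 hc fun z hz => ?_)
    have := 𝔏.P_eq_zero h z
    simpa [F.P_a_plane hz, ht] using this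
  subst ht
  simpa [F.proj_a] using h

/-- The plane has Witt index one. If the y-coordinate γ of c is nonzero, then γc' - γ'c lies in ⟨c₁,
c₂⟩, is singular and is orthogonal to c; this forces it to vanish. -/
theorem exists_smul_eq {c c' : V} (hc : c ∈ F.plane) (hc0 : c ≠ 0)
    (hQ : 𝔏.Q c = 0) (hc' : c' ∈ F.plane) (hQ' : 𝔏.Q c' = 0) (hP : 𝔏.P c c' = 0) :
    ∃ k : K, c' = k • c := by
  obtain ⟨α, β, γ, rfl⟩ := F.mem_plane.1 hc
  obtain ⟨α', β', γ', rfl⟩ := F.mem_plane.1 hc'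
  rw [P_comb] at hP
  rw [Q_comb] at hQ hQ'
  have hd := F.Q_y
  generalize 𝔏.Q F.y = δ at *
  have key : ∃ k : K, α' = k * α ∧ β' = k * β ∧ γ' = k * γ := by
    by_cases hγ : γ = 0
    · subst hγ
      have hαβ : α = 0 ∨ β = 0 := by simpa using hQ
      rcases hαβ with rfl | rfl
      · have hβ : β ≠ 0 := by
          rintro rfl
          simp at hc0
        have hα' : α' = 0 := by simpa [hβ] using hP
        have hγ' : γ' = 0 := by simpa [hα', hd] using hQ'
        exact ⟨β' / β, by simp [hα'], by field_simp, by simp [hγ']⟩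
      · have hα : α ≠ 0 := by
          rintro rfl
          simp at hc0
        have hβ' : β' = 0 := by simpa [hα] using hP
        have hγ' : γ' = 0 := by simpa [hβ', hd] using hQ'
        exact ⟨α' / α, by field_simp, by simp [hβ'], by simp [hγ']⟩
    · have hαβ : α * β ≠ 0 := by
        rw [eq_neg_of_add_eq_zero_left hQ]
        exact neg_ne_zero.2 (mul_ne_zero (mul_ne_zero hγ hγ) hd)
      obtain ⟨hα, hβ⟩ := mul_ne_zero_iff.1 hαβ
      have h1 : (γ * α' - γ' * α) * (γ * β' - γ' * β) = 0 := by
        linear_combination γ ^ 2 * hQ' + γ' ^ 2 * hQ - γ * γ' * hP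
      have h2 : α * (γ * β' - γ' * β) + β * (γ * α' - γ' * α) = 0 := by
        linear_combination γ * hP - 2 * γ' * hQ
      have h3 : γ * α' - γ' * α = 0 ∧ γ * β' - γ' * β = 0 := by
        rcases mul_eq_zero.1 h1 with h | h <;> rw [h] at h2 <;> simp [hα, hβ] at h2 <;> simp [h, h2]
      refine ⟨γ' / γ, ?_, ?_, by field_simp⟩
      · field_simp
        linear_combination h3.1
      · field_simp
        linear_combination h3.2
  obtain ⟨k, rfl, rfl, rfl⟩ := key
  exact ⟨k, by module⟩

theorem vertex_mem_S : F.vertex ∈ 𝔏.S := (𝔏.mk_mem_S _).2 ⟨F.sing_a, F.proj_a⟩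

theorem mem_cone_of_isPair {c : V} (hc : c ∈ F.plane) (hp : 𝔏.IsPair F.a c) :
    projPts (Submodule.span K {F.a, c}) ⊆ F.cone := by
  intro p hp'
  refine ⟨Projectivization.mk K c hp.right_ne_zero, ⟨(mk_mem_projPts _).2 hc,
    (𝔏.mk_mem_S _).2 ⟨hp.sing_right, hp.proj_right_ne_zero⟩⟩, ?_⟩
  rw [vertex, Projectivization.submodule_mk, Projectivization.submodule_mk, ← Submodule.span_union]
  exact hp'

theorem mk_mem_cone (h2 : (2 : K) ≠ 0) {v : V} (hv : v ≠ 0)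
    (h : Projectivization.mk K v hv ∈ F.cone) :
    ∃ c ∈ F.plane, 𝔏.Q c = 0 ∧ c ≠ 0 ∧ 𝔏.IsPair F.a c ∧ v ∈ Submodule.span K {F.a, c} := by
  obtain ⟨p, ⟨hp, hpS⟩, hvp⟩ := h
  induction p using Projectivization.ind with
  | h c hc =>
  rw [mk_mem_projPts] at hp
  have hQ := ((𝔏.mk_mem_S hc).1 hpS).1.2
  refine ⟨c, hp, hQ, hc, F.isPair h2 hp hc hQ, ?_⟩
  rwa [vertex, Projectivization.submodule_mk, Projectivization.submodule_mk,
    Projectivization.submodule_mk, ← Submodule.span_union,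
    Submodule.span_singleton_le_iff_mem] at hvp

theorem IsGen.mem_projLines (h2 : (2 : K) ≠ 0) {F : 𝔏.Frame} {L : Set (ℙ K V)} (h : F.IsGen L) :
    L ∈ 𝔏.projLines := by
  obtain ⟨c, hc, hc0, hQ, rfl⟩ := h
  exact (F.isPair h2 hc hc0 hQ).projPts_mem

theorem IsGen.vertex_mem {F : 𝔏.Frame} {L : Set (ℙ K V)} (h : F.IsGen L) : F.vertex ∈ L := by
  obtain ⟨c, hc, hc0, hQ, rfl⟩ := h
  exact (mk_mem_projPts _).2 (Submodule.subset_span (by simp))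

theorem IsGen.subset_cone (h2 : (2 : K) ≠ 0) {F : 𝔏.Frame} {L : Set (ℙ K V)} (h : F.IsGen L) :
    L ⊆ F.cone := by
  obtain ⟨c, hc, hc0, hQ, rfl⟩ := h
  exact F.mem_cone_of_isPair hc (F.isPair h2 hc hc0 hQ)

/-- Two points of the line lie on generators. If these are orthogonal they agree and equal the line;
otherwise `mem_of_meets` applies. Either way the line contains the vertex. -/
theorem isGen_of_subset_cone (h2 : (2 : K) ≠ 0) {L : Set (ℙ K V)} (hL : L ∈ 𝔏.projLines)
    (h : L ⊆ F.cone) : F.IsGen L := by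
  have haL : F.vertex ∈ L := by
    by_contra haL
    obtain ⟨p, hp⟩ := exists_mem_of_mem_projLines hL
    induction p using Projectivization.ind with
    | h v hv =>
    obtain ⟨w, hvw, rfl⟩ := exists_isPair_of_mem hL hv hp
    have hwL : Projectivization.mk K w hvw.right_ne_zero ∈ projPts (Submodule.span K {v, w}) :=
      (mk_mem_projPts _).2 (Submodule.subset_span (by simp))
    obtain ⟨c, hc, hQ, hc0, hac, hv'⟩ := F.mk_mem_cone h2 hv (h hp)
    obtain ⟨d, hd, hQd, hd0, had, hw'⟩ := F.mk_mem_cone h2 hvw.right_ne_zero (h hwL)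
    by_cases hcd : 𝔏.P c d = 0
    · obtain ⟨k, rfl⟩ := F.exists_smul_eq hc hc0 hQ hd hQd hcd
      have hk : k ≠ 0 := fun hk => hd0 (by simp [hk])
      have hle : Submodule.span K {v, w} ≤ Submodule.span K {F.a, c} := by
        rw [Submodule.span_le, Set.pair_subset_iff]
        refine ⟨hv', ?_⟩
        obtain ⟨s, t, rfl⟩ := Submodule.mem_span_pair.1 hw'
        exact Submodule.mem_span_pair.2 ⟨s, t * k, by module⟩
      have : FiniteDimensional K (Submodule.span K {F.a, c}) :=
        FiniteDimensional.span_of_finite K (by simp)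
      have heq := Submodule.eq_of_le_of_finrank_eq hle
        ((projPts_mem_projLines.1 hL).1.trans (projPts_mem_projLines.1 hac.projPts_mem).1.symm)
      rw [heq] at haL
      exact haL ((mk_mem_projPts _).2 (Submodule.subset_span (by simp)))
    · exact haL (mem_of_meets F.a_ne_zero hac had hcd hL ((mk_mem_projPts _).2 hv') hp
        ((mk_mem_projPts _).2 hw') hwL)
  obtain ⟨x, hx, rfl⟩ := exists_isPair_of_mem hL F.a_ne_zero haL
  obtain ⟨c, hc, hQ, hc0, -, hxc⟩ := F.mk_mem_cone h2 hx.right_ne_zero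
    (h ((mk_mem_projPts _).2 (Submodule.subset_span (by simp))))
  exact ⟨c, hc, hc0, hQ, by rw [span_pair_eq_of_mem hxc hx.ne_smul]⟩

theorem subset_cone_iff (h2 : (2 : K) ≠ 0) {L : Set (ℙ K V)} (hL : L ∈ 𝔏.projLines) :
    L ⊆ F.cone ↔ F.IsGen L :=
  ⟨F.isGen_of_subset_cone h2 hL, fun h => h.subset_cone h2⟩

theorem IsGen.exists_nonorthogonal (h2 : (2 : K) ≠ 0) {F : 𝔏.Frame} {L M : Set (ℙ K V)} (hL : F.IsGen L) (hM : F.IsGen M)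
    (hLM : L ≠ M) : ∃ x y, 𝔏.IsPair F.a x ∧ 𝔏.IsPair F.a y ∧ 𝔏.P x y ≠ 0 ∧
      L = projPts (Submodule.span K {F.a, x}) ∧ M = projPts (Submodule.span K {F.a, y}) := by
  obtain ⟨c, hc, hc0, hQ, rfl⟩ := hL
  obtain ⟨d, hd, hd0, hQd, rfl⟩ := hM
  refine ⟨c, d, F.isPair h2 hc hc0 hQ, F.isPair h2 hd hd0 hQd, fun hcd => ?_, rfl, rfl⟩
  obtain ⟨k, rfl⟩ := F.exists_smul_eq hc hc0 hQ hd hQd hcd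
  refine hLM (by rw [span_pair_eq_of_mem (x := k • c) (y := c)
    (Submodule.smul_mem _ _ (Submodule.subset_span (by simp)))
    (F.isPair h2 hd hd0 hQd).ne_smul])

/-- A projective line that meets two generators passes through the vertex. -/
theorem vertex_mem_of_meets (h2 : (2 : K) ≠ 0) {L L' M : Set (ℙ K V)} (hL : F.IsGen L)
    (hL' : F.IsGen L') (hLL' : L ≠ L') (hM : M ∈ 𝔏.projLines) (h : ∃ p, p ∈ L ∧ p ∈ M)
    (h' : ∃ p, p ∈ L' ∧ p ∈ M) : F.vertex ∈ M := by
  obtain ⟨x, y, hx, hy, hxy, rfl, rfl⟩ := hL.exists_nonorthogonal h2 hL' hLL'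
  obtain ⟨p, hp, hpM⟩ := h
  obtain ⟨q, hq, hqM⟩ := h'
  exact mem_of_meets F.a_ne_zero hx hy hxy hM hp hpM hq hqM

/-- A linear functional that does not vanish on the plane is nonzero at two points of the
conic. -/
theorem exists_two_nonorthogonal (h2 : (2 : K) ≠ 0) {z x : V} (hx : x ∈ F.plane)
    (hzx : 𝔏.P z x ≠ 0) : ∃ c ∈ F.plane, ∃ d ∈ F.plane, 𝔏.Q c = 0 ∧ 𝔏.Q d = 0 ∧ 𝔏.P c d ≠ 0 ∧
      𝔏.P z c ≠ 0 ∧ 𝔏.P z d ≠ 0 := by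
  have hd := F.Q_y
  -- With δ = Q(y), the vectors -δc₁ + c₂ ± y give, together with c₁ and c₂, four pairwise
  -- nonorthogonal points of the conic. A line of the plane contains at most two of them. This works
  -- even over the field of three elements, where the conic has no other points.
  have hN : ∀ e : K, e * e = 1 → ∃ n ∈ F.plane, 𝔏.Q n = 0 ∧ 𝔏.P F.c₁ n ≠ 0 ∧ 𝔏.P F.c₂ n ≠ 0 ∧
      n = (-𝔏.Q F.y) • F.c₁ + (1 : K) • F.c₂ + e • F.y := fun e he => by
    refine ⟨_, F.mem_plane.2 ⟨_, _, _, rfl⟩, ?_, ?_, ?_, rfl⟩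
    · rw [Q_comb, he]
      ring
    · simp [P_c₁_c₁, P_c₁_c₂, P_c₁_y]
    · simp [P_c₂_c₁, P_c₂_c₂, P_c₂_y, hd]
  obtain ⟨n, hn, hQn, hc₁n, hc₂n, hn_eq⟩ := hN 1 (by ring)
  obtain ⟨m, hm, hQm, hc₁m, hc₂m, hm_eq⟩ := hN (-1) (by ring)
  have hnm : 𝔏.P n m ≠ 0 := by
    rw [hn_eq, hm_eq, P_comb]
    have : -𝔏.Q F.y * 1 + 1 * -𝔏.Q F.y + 2 * (1 * -1 * 𝔏.Q F.y) = -(2 * (2 * 𝔏.Q F.y)) := by ring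
    rw [this, neg_ne_zero]
    exact mul_ne_zero h2 (mul_ne_zero h2 hd)
  have hzn : 𝔏.P z n = -𝔏.Q F.y * 𝔏.P z F.c₁ + 𝔏.P z F.c₂ + 𝔏.P z F.y := by
    rw [hn_eq]
    simp
  have hzm : 𝔏.P z m = -𝔏.Q F.y * 𝔏.P z F.c₁ + 𝔏.P z F.c₂ - 𝔏.P z F.y := by
    rw [hm_eq]
    simp [sub_eq_add_neg]
  have hc₁₂ : 𝔏.P F.c₁ F.c₂ ≠ 0 := by
    rw [F.P_c₁_c₂]
    exact one_ne_zero
  -- n + m is twice -δc₁ + c₂, so the y-coordinate drops out.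
  have hw : 𝔏.P z n = 0 → 𝔏.P z m = 0 → -𝔏.Q F.y * 𝔏.P z F.c₁ + 𝔏.P z F.c₂ = 0 := fun h h' => by
    rw [hzn] at h
    rw [hzm] at h'
    refine (mul_eq_zero.1 ?_).resolve_left h2
    linear_combination h + h'
  by_cases h₁ : 𝔏.P z F.c₁ = 0 <;> by_cases h₂ : 𝔏.P z F.c₂ = 0
  · have h₃ : 𝔏.P z F.y ≠ 0 := fun h₃ => by
      obtain ⟨α, β, γ, rfl⟩ := F.mem_plane.1 hx
      simp [h₁, h₂, h₃] at hzx
    refine ⟨n, hn, m, hm, hQn, hQm, hnm, ?_, ?_⟩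
    · simpa [hzn, h₁, h₂] using h₃
    · simpa [hzm, h₁, h₂] using h₃
  · by_cases hn' : 𝔏.P z n = 0
    · refine ⟨F.c₂, F.c₂_mem, m, hm, F.sing_c₂.2, hQm, hc₂m, h₂, fun hm' => h₂ ?_⟩
      simpa [h₁] using hw hn' hm'
    · exact ⟨F.c₂, F.c₂_mem, n, hn, F.sing_c₂.2, hQn, hc₂n, h₂, hn'⟩
  · by_cases hn' : 𝔏.P z n = 0
    · refine ⟨F.c₁, F.c₁_mem, m, hm, F.sing_c₁.2, hQm, hc₁m, h₁, fun hm' => h₁ ?_⟩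
      simpa [h₂, hd] using hw hn' hm'
    · exact ⟨F.c₁, F.c₁_mem, n, hn, F.sing_c₁.2, hQn, hc₁n, h₁, hn'⟩
  · exact ⟨F.c₁, F.c₁_mem, F.c₂, F.c₂_mem, F.sing_c₁.2, F.sing_c₂.2, hc₁₂, h₁, h₂⟩

end Frame

end LaguerreSpace

namespace LaguerreSpace

variable {K : Type u} {V : Type v} [Field K] [AddCommGroup V] [Module K V] {𝔏 : LaguerreSpace K V}

/-! ### Existence of pairs and frames -/

/-- The vector w is orthogonal to a but not to x, hence it detects the coefficient of x in any
combination that lies in the radical. -/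
theorem IsPair.of_separated {a x w : V} (ha : 𝔏.Sing a) (hx : 𝔏.Sing x) (hax : 𝔏.P a x = 0)
    (ha0 : 𝔏.proj a ≠ 0) (haw : 𝔏.P a w = 0) (hxw : 𝔏.P x w ≠ 0) : 𝔏.IsPair a x := by
  refine ⟨ha, hx, hax, fun s t h => ?_⟩
  have ht : t = 0 := by
    have := 𝔏.P_eq_zero h w
    simpa [haw, hxw] using this
  subst ht
  simpa [ha0] using h

theorem coe_mem_sup (b : 𝔏.B) : (b : V) ∈ 𝔏.T ⊔ 𝔏.B := Submodule.mem_sup_right b.2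

/-- Ruledness enters here: the totally singular plane contains a vector orthogonal, but not
proportional, to the projection of a. -/
theorem exists_isPair_of_sing {a : V} (ha : 𝔏.Sing a) (ha0 : 𝔏.proj a ≠ 0) :
    ∃ x, 𝔏.IsPair a x := by
  obtain ⟨W, hW, hQW⟩ := 𝔏.ruled
  obtain ⟨x, hQ, hP, hx⟩ := QuadraticForm.exists_singular_orthogonal W hW hQW (𝔏.proj a)
  refine ⟨x, ha, ⟨coe_mem_sup x, by rwa [Q_apply, proj_base]⟩, by rwa [P_apply, proj_base],
    fun s t h => ?_⟩
  rw [map_add, map_smul, map_smul, proj_base] at h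
  have ht : t = 0 := by
    by_contra ht
    refine hx (-(t⁻¹ * s)) ?_
    have := congrArg (t⁻¹ • ·) (eq_neg_of_add_eq_zero_right h)
    simp only [smul_smul, inv_mul_cancel₀ ht, one_smul, smul_neg] at this
    rw [this, neg_smul]
  subst ht
  simpa [ha0] using h

theorem IsPair.exists_partner {a x : V} (h : 𝔏.IsPair a x) :
    ∃ y, 𝔏.IsPair a y ∧ 𝔏.P x y = 1 := by
  obtain ⟨y, hQ, hay, hxy⟩ := QuadraticForm.exists_hyperbolic_partner 𝔏.nondegenerate
    (b := 𝔏.proj a) (x := 𝔏.proj x) h.proj_left_ne_zero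
    (fun s hs => one_ne_zero (h.indep (-s) 1 (by simp [hs])).2) h.sing_right.2
    (by rw [← P_apply, h.ortho])
  have hxy' : 𝔏.P x y = 1 := by rw [P_apply, proj_base, hxy]
  refine ⟨y, IsPair.of_separated (w := x) h.sing_left
    ⟨coe_mem_sup y, by rwa [Q_apply, proj_base]⟩ (by rwa [P_apply, proj_base])
    h.proj_left_ne_zero h.ortho ?_, hxy'⟩
  rw [P_comm, hxy']
  exact one_ne_zero

theorem exists_frame [FiniteDimensional K V] (hB : 5 ≤ Module.finrank K 𝔏.B) {a x y : V}
    (hx : 𝔏.IsPair a x) (hy : 𝔏.IsPair a y) (hxy : 𝔏.P x y = 1) :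
    ∃ F : 𝔏.Frame, F.a = a ∧ F.c₁ = x ∧ F.c₂ = y := by
  obtain ⟨z, hQ, haz, hxz, hyz⟩ := QuadraticForm.exists_nonsingular_orthogonal 𝔏.nondegenerate hB
    (b := 𝔏.proj a) (x := 𝔏.proj x) (y := 𝔏.proj y) hx.proj_left_ne_zero hx.sing_right.2
    hy.sing_right.2 (by rw [← P_apply, hxy]) (by rw [← P_apply, hx.ortho])
    (by rw [← P_apply, hy.ortho])
  exact ⟨⟨a, x, y, z, hx.proj_left_ne_zero, hx.sing_left, hx.sing_right, hy.sing_right,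
    coe_mem_sup z, by rwa [Q_apply, proj_base], hxy, by rwa [P_apply, proj_base],
    by rwa [P_apply, proj_base], hx.ortho, hy.ortho, by rwa [P_apply, proj_base]⟩, rfl, rfl, rfl⟩

/-- Two nonorthogonal lines through a point are generators of a projective cone. -/
theorem exists_frame_isGen [FiniteDimensional K V] (hB : 5 ≤ Module.finrank K 𝔏.B) {a x y : V}
    (hx : 𝔏.IsPair a x) (hy : 𝔏.IsPair a y) (hxy : 𝔏.P x y ≠ 0) :
    ∃ F : 𝔏.Frame, F.a = a ∧ F.IsGen (projPts (Submodule.span K {a, x})) ∧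
      F.IsGen (projPts (Submodule.span K {a, y})) := by
  have hy' : 𝔏.IsPair a ((𝔏.P x y)⁻¹ • y) := by
    refine ⟨hy.sing_left, ⟨Submodule.smul_mem _ _ hy.sing_right.1, ?_⟩, ?_, fun s t h => ?_⟩
    · rw [Q_smul, hy.sing_right.2, mul_zero]
    · rw [map_smul, hy.ortho, smul_zero]
    · rw [smul_smul] at h
      simpa [hxy] using hy.indep _ _ h
  obtain ⟨F, rfl, rfl, h⟩ := exists_frame hB hx hy' (by simp [hxy])
  refine ⟨F, rfl, ⟨F.c₁, F.c₁_mem, hx.right_ne_zero, F.sing_c₁.2, rfl⟩,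
    ⟨F.c₂, F.c₂_mem, h ▸ hy'.right_ne_zero, F.sing_c₂.2, ?_⟩⟩
  rw [span_pair_eq_of_mem (x := F.c₂) (y := y) ?_ ?_]
  · rw [h]
    exact Submodule.smul_mem _ _ (Submodule.subset_span (by simp))
  · rw [h]
    exact hy'.ne_smul

theorem exists_frame_of_mem_S [FiniteDimensional K V] (hB : 5 ≤ Module.finrank K 𝔏.B) {p : ℙ K V}
    (hp : p ∈ 𝔏.S) : ∃ F : 𝔏.Frame, F.vertex = p := by
  induction p using Projectivization.ind with
  | h a ha =>
  obtain ⟨hs, h0⟩ := (𝔏.mk_mem_S ha).1 hp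
  obtain ⟨x, hx⟩ := exists_isPair_of_sing hs h0
  obtain ⟨y, hy, hxy⟩ := hx.exists_partner
  obtain ⟨F, rfl, -⟩ := exists_frame hB hx hy hxy
  exact ⟨F, rfl⟩

/-! ### Frames describe the projective cones -/

theorem Frame.finrank_plane (F : 𝔏.Frame) (h2 : (2 : K) ≠ 0) : Module.finrank K F.plane = 3 := by
  have hli : LinearIndependent K ![F.c₁, F.c₂, F.y] := by
    rw [Fintype.linearIndependent_iff]
    intro g hg
    simp only [Fin.sum_univ_three, Matrix.cons_val_zero, Matrix.cons_val_one, Matrix.cons_val] at hg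
    have h₁ := congrArg (𝔏.P F.c₁) hg
    have h₂ := congrArg (𝔏.P F.c₂) hg
    have h₃ := congrArg (𝔏.P F.y) hg
    simp only [map_add, map_smul, smul_eq_mul, F.P_c₁_c₁, F.P_c₂_c₂, F.P_c₂_c₁, F.P_c₁_c₂,
      F.P_y_c₁, F.P_y_c₂, F.P_c₁_y, F.P_c₂_y, F.P_y_y, map_zero] at h₁ h₂ h₃
    intro i
    fin_cases i
    · simpa using h₂
    · simpa using h₁
    · simpa [h2, F.Q_y] using h₃
  have := finrank_span_eq_card hli
  rwa [Matrix.range_cons, Matrix.range_cons, Matrix.range_cons, Matrix.range_empty, Set.union_empty,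
    Set.singleton_union, Set.singleton_union, Fintype.card_fin] at this

/-- Three pairwise nonorthogonal singular vectors give three distinct points of the conic. A line in
it would contain orthogonal singular vectors that are not proportional. The vertex is off the plane
because it is orthogonal to it. -/
theorem Frame.isProjConeAt (F : 𝔏.Frame) (h2 : (2 : K) ≠ 0) :
    𝔏.IsProjConeAt F.cone F.vertex := by
  refine ⟨?_, F.plane, F.finrank_plane h2, ⟨F.plane, F.finrank_plane h2, rfl, ?_, ?_⟩, ?_, rfl⟩
  · intro p hp
    induction p using Projectivization.ind with
    | h v hv =>
    obtain ⟨c, -, -, -, hac, hvc⟩ := F.mk_mem_cone h2 hv hp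
    exact projLines_subset_S hac.projPts_mem ((mk_mem_projPts hv).2 hvc)
  · have hc₁ : F.c₁ ≠ 0 := fun h => one_ne_zero (F.P_c₁_c₂.symm.trans (by simp [h]))
    have hc₂ : F.c₂ ≠ 0 := fun h => one_ne_zero (F.P_c₁_c₂.symm.trans (by simp [h]))
    obtain ⟨n, hn, hQn, hc₁n, hc₂n⟩ : ∃ n ∈ F.plane, 𝔏.Q n = 0 ∧ 𝔏.P F.c₁ n ≠ 0 ∧
        𝔏.P F.c₂ n ≠ 0 := by
      refine ⟨_, F.mem_plane.2 ⟨-𝔏.Q F.y, 1, 1, rfl⟩, ?_, ?_, ?_⟩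
      · rw [F.Q_comb]
        ring
      · simp [F.P_c₁_c₁, F.P_c₁_c₂, F.P_c₁_y]
      · simp [F.P_c₂_c₁, F.P_c₂_c₂, F.P_c₂_y, F.Q_y]
    have hn0 : n ≠ 0 := fun h => hc₁n (by simp [h])
    have hmem : ∀ {c : V} (hc : c ≠ 0), c ∈ F.plane → 𝔏.Q c = 0 →
        Projectivization.mk K c hc ∈ projPts F.plane ∩ 𝔏.S := fun hc h hQ =>
      ⟨(mk_mem_projPts hc).2 h, (𝔏.mk_mem_S hc).2
        ⟨⟨F.plane_le h, hQ⟩, (F.isPair h2 h hc hQ).proj_right_ne_zero⟩⟩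
    have hne : ∀ {c d : V} (hc : c ≠ 0) (hd : d ≠ 0), 𝔏.Q c = 0 → 𝔏.P c d ≠ 0 →
        Projectivization.mk K c hc ≠ Projectivization.mk K d hd := fun {c d} hc hd hQ hP h => by
      obtain ⟨k, rfl⟩ := (Projectivization.mk_eq_mk_iff' K _ _ hd hc).1 h.symm
      rw [map_smul, P_self, hQ, mul_zero, smul_zero] at hP
      exact hP rfl
    have h3 : ({Projectivization.mk K _ hc₁, Projectivization.mk K _ hc₂,
        Projectivization.mk K _ hn0} : Set (ℙ K V)).encard = 3 :=
      Set.encard_eq_three.2 ⟨_, _, _, hne hc₁ hc₂ F.sing_c₁.2 (by simp [F.P_c₁_c₂]),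
        hne hc₁ hn0 F.sing_c₁.2 hc₁n, hne hc₂ hn0 F.sing_c₂.2 hc₂n, rfl⟩
    rw [← h3]
    refine Set.encard_le_encard ?_
    rintro _ (rfl | rfl | rfl)
    exacts [hmem _ F.c₁_mem F.sing_c₁.2, hmem _ F.c₂_mem F.sing_c₂.2, hmem _ hn hQn]
  · rintro X ⟨W, hW, hWc, rfl, p, hpW, hpS⟩ hX
    rw [projPts_subset_cone] at hWc
    induction p using Projectivization.ind with
    | h v hv =>
    have hmem : ∀ w ∈ W, 𝔏.proj w ≠ 0 → w ∈ F.plane := fun w hw hw0 =>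
      (mk_mem_projPts (ne_zero_of_proj_ne_zero hw0)).1
        (hX ⟨(mk_mem_projPts _).2 hw, (𝔏.mk_mem_S _).2 ⟨hWc w hw, hw0⟩⟩).1
    have hv0 := ((𝔏.mk_mem_S hv).1 hpS).2
    rw [mk_mem_projPts] at hpW
    have hle : W ≤ Submodule.span K {v} := by
      intro w hw
      have hwp : w ∈ F.plane := by
        -- `hX` says nothing about vectors of `T`, but w + v has the same projection as v.
        by_cases hw0 : 𝔏.proj w = 0
        · have := hmem _ (W.add_mem hw hpW) (by rwa [map_add, hw0, zero_add])
          exact (Submodule.add_mem_iff_left _ (hmem v hpW hv0)).1 this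
        · exact hmem w hw hw0
      have hvw : 𝔏.P v w = 0 := by
        have := 𝔏.Q_add v w
        rw [(hWc _ (W.add_mem hpW hw)).2, (hWc v hpW).2, (hWc w hw).2] at this
        simpa using this.symm
      obtain ⟨k, rfl⟩ := F.exists_smul_eq (hmem v hpW hv0) hv (hWc v hpW).2 hwp (hWc w hw).2 hvw
      exact Submodule.smul_mem _ _ (Submodule.mem_span_singleton_self v)
    have h3 := Submodule.finrank_mono hle
    have h4 := finrank_span_le_card (R := K) ({v} : Set V)
    rw [Set.toFinset_singleton, Finset.card_singleton] at h4
    omega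
  · intro h
    rw [Frame.vertex, mk_mem_projPts] at h
    exact F.a_ne_zero (F.eq_zero_of_ortho h2 h fun z hz => F.P_a_plane hz)

/-- Three points of the conic yield the frame: d₁ and a rescaled d₂ form the hyperbolic pair, and y
is the component of d₃ orthogonal to both. The vertex a is orthogonal to each d because a + d lies
on the cone and is thus singular. -/
theorem exists_frame_of_isProjConeAt (h2 : (2 : K) ≠ 0) {Z : Set (ℙ K V)} {p : ℙ K V}
    (h : 𝔏.IsProjConeAt Z p) : ∃ F : 𝔏.Frame, F.vertex = p ∧ F.cone = Z := by
  obtain ⟨hZS, A, hA, ⟨-, -, -, h3, hline⟩, hpA, hZ⟩ := h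
  have : FiniteDimensional K A := Module.finite_of_finrank_eq_succ hA
  -- This encodes that the conic contains no line. Only v must lie outside `T`, so that the claim
  -- applies to y below.
  have hsmul : ∀ v ∈ A, ∀ w ∈ A, 𝔏.Sing v → 𝔏.proj v ≠ 0 → 𝔏.Sing w → 𝔏.P v w = 0 →
      ∃ k : K, w = k • v := by
    intro v hv w hw hsv hv0 hsw hvw
    by_contra! hk
    have hv0' := ne_zero_of_proj_ne_zero hv0
    have hli : LinearIndependent K ![v, w] :=
      (LinearIndependent.pair_iff' hv0').2 fun k h => hk k h.symm
    refine hline (projPts (Submodule.span K {v, w}) ∩ 𝔏.S)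
      ⟨Submodule.span K {v, w}, ?_, 𝔏.projPts_subset_cone.2 fun z hz => ?_, rfl, ?_⟩ ?_
    · have := finrank_span_eq_card hli
      rwa [Matrix.range_cons, Matrix.range_cons, Matrix.range_empty, Set.union_empty,
        Set.singleton_union, Fintype.card_fin] at this
    · obtain ⟨s, t, rfl⟩ := Submodule.mem_span_pair.1 hz
      exact hsv.combination hsw hvw s t
    · exact ⟨Projectivization.mk K v hv0', (mk_mem_projPts _).2 (Submodule.subset_span (by simp)),
        (𝔏.mk_mem_S _).2 ⟨hsv, hv0⟩⟩
    · refine Set.inter_subset_inter_left _ (projPts_subset_iff.2 ?_)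
      rw [Submodule.span_le, Set.pair_subset_iff]
      exact ⟨hv, hw⟩
  obtain ⟨C, hCs, hC3⟩ := Set.exists_subset_encard_eq h3
  obtain ⟨p₁, p₂, p₃, h₁₂, h₁₃, h₂₃, rfl⟩ := Set.encard_eq_three.1 hC3
  obtain ⟨hp₁, hs₁⟩ := hCs (show p₁ ∈ _ by simp)
  obtain ⟨hp₂, hs₂⟩ := hCs (show p₂ ∈ _ by simp)
  obtain ⟨hp₃, hs₃⟩ := hCs (show p₃ ∈ _ by simp)
  induction p using Projectivization.ind with
  | h a ha =>
  induction p₁ using Projectivization.ind with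
  | h d₁ hd₁ =>
  induction p₂ using Projectivization.ind with
  | h d₂ hd₂ =>
  induction p₃ using Projectivization.ind with
  | h d₃ hd₃ =>
  have hmemZ : ∀ {d : V} (hd : d ≠ 0), Projectivization.mk K d hd ∈ projPts A →
      Projectivization.mk K d hd ∈ 𝔏.S → ∀ {v : V} (hv : v ≠ 0), v ∈ Submodule.span K {a, d} →
      𝔏.Sing v ∧ 𝔏.proj v ≠ 0 := by
    intro d hd hdA hdS v hv hvd
    refine (𝔏.mk_mem_S hv).1 (hZS ?_)
    rw [hZ]
    refine ⟨_, ⟨hdA, hdS⟩, ?_⟩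
    rwa [Projectivization.submodule_mk, Projectivization.submodule_mk,
      Projectivization.submodule_mk, ← Submodule.span_union,
      Submodule.span_singleton_le_iff_mem]
  obtain ⟨hsa, hpa⟩ := hmemZ hd₁ hp₁ hs₁ ha (Submodule.subset_span (by simp))
  rw [mk_mem_projPts] at hpA
  have hort : ∀ {d : V} (hd : d ≠ 0), Projectivization.mk K d hd ∈ projPts A →
      Projectivization.mk K d hd ∈ 𝔏.S → 𝔏.P a d = 0 := by
    intro d hd hdA hdS
    have had : a + d ≠ 0 := fun h => hpA (by
      rw [eq_neg_of_add_eq_zero_left h]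
      exact A.neg_mem ((mk_mem_projPts hd).1 hdA))
    have h1 := (hmemZ hd hdA hdS had (Submodule.add_mem _ (Submodule.subset_span (by simp))
      (Submodule.subset_span (by simp)))).1.2
    rw [Q_add, hsa.2, ((𝔏.mk_mem_S hd).1 hdS).1.2] at h1
    simpa using h1
  have ho₁ := hort hd₁ hp₁ hs₁
  have ho₂ := hort hd₂ hp₂ hs₂
  have ho₃ := hort hd₃ hp₃ hs₃
  rw [mk_mem_projPts] at hp₁ hp₂ hp₃
  obtain ⟨hs₁, hn₁⟩ := (𝔏.mk_mem_S _).1 hs₁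
  obtain ⟨hs₂, hn₂⟩ := (𝔏.mk_mem_S _).1 hs₂
  obtain ⟨hs₃, hn₃⟩ := (𝔏.mk_mem_S _).1 hs₃
  have hP : ∀ {v w : V} (hv : v ≠ 0) (hw : w ≠ 0), v ∈ A → w ∈ A → 𝔏.Sing v → 𝔏.proj v ≠ 0 →
      𝔏.Sing w → Projectivization.mk K v hv ≠ Projectivization.mk K w hw → 𝔏.P v w ≠ 0 := by
    intro v w hv hw hvA hwA hsv hv0 hsw hne h
    obtain ⟨k, hk⟩ := hsmul v hvA w hwA hsv hv0 hsw h
    exact hne ((Projectivization.mk_eq_mk_iff' K _ _ hw hv).2 ⟨k, hk.symm⟩).symm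
  have hP₁₂ := hP hd₁ hd₂ hp₁ hp₂ hs₁ hn₁ hs₂ h₁₂
  have hP₁₃ := hP hd₁ hd₃ hp₁ hp₃ hs₁ hn₁ hs₃ h₁₃
  have hP₂₃ := hP hd₂ hd₃ hp₂ hp₃ hs₂ hn₂ hs₃ h₂₃
  obtain ⟨c₂, hc₂⟩ : ∃ c₂, c₂ = (𝔏.P d₁ d₂)⁻¹ • d₂ := ⟨_, rfl⟩
  have hc₂A : c₂ ∈ A := hc₂ ▸ A.smul_mem _ hp₂
  have hsc₂ : 𝔏.Sing c₂ := by
    rw [hc₂]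
    exact ⟨Submodule.smul_mem _ _ hs₂.1, by rw [Q_smul, hs₂.2, mul_zero]⟩
  have h1c₂ : 𝔏.P d₁ c₂ = 1 := by
    rw [hc₂, map_smul, smul_eq_mul, inv_mul_cancel₀ hP₁₂]
  have hac₂ : 𝔏.P a c₂ = 0 := by rw [hc₂, map_smul, ho₂, smul_zero]
  have hc₂3 : 𝔏.P c₂ d₃ ≠ 0 := by simp [hc₂, hP₁₂, hP₂₃]
  have h11 := hs₁.P_self
  have h22 := hsc₂.P_self
  have h21 : 𝔏.P c₂ d₁ = 1 := by rw [P_comm, h1c₂]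
  obtain ⟨y, hy⟩ : ∃ y, y = d₃ - 𝔏.P c₂ d₃ • d₁ - 𝔏.P d₁ d₃ • c₂ := ⟨_, rfl⟩
  have hyA : y ∈ A := hy ▸ A.sub_mem (A.sub_mem hp₃ (A.smul_mem _ hp₁)) (A.smul_mem _ hc₂A)
  have hyU : y ∈ 𝔏.T ⊔ 𝔏.B := hy ▸ Submodule.sub_mem _
    (Submodule.sub_mem _ hs₃.1 (Submodule.smul_mem _ _ hs₁.1)) (Submodule.smul_mem _ _ hsc₂.1)
  have h1y : 𝔏.P d₁ y = 0 := by simp [hy, h11, h1c₂]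
  have h2y : 𝔏.P c₂ y = 0 := by simp [hy, h21, h22]
  have hay : 𝔏.P a y = 0 := by simp [hy, ho₁, ho₃, hac₂]
  have hQy : 𝔏.Q y ≠ 0 := by
    -- A singular y would be a multiple of d₁, hence zero by orthogonality to c₂. Then d₃ is a
    -- combination of d₁ and c₂ with nonzero coefficients, which is not singular.
    intro hQy
    obtain ⟨k, hk⟩ := hsmul d₁ hp₁ y hyA hs₁ hn₁ ⟨hyU, hQy⟩ h1y
    have hk0 : k = 0 := by simpa [hk, h21] using h2y
    rw [hk0, zero_smul] at hk
    have hd₃ : d₃ = 𝔏.P c₂ d₃ • d₁ + 𝔏.P d₁ d₃ • c₂ := by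
      rw [hk, sub_sub] at hy
      exact sub_eq_zero.1 hy.symm
    have hQ₃ := hs₃.2
    rw [hd₃, Q_add, Q_smul, Q_smul, hs₁.2, hsc₂.2] at hQ₃
    simp only [map_smul, LinearMap.smul_apply, h1c₂, smul_eq_mul, mul_zero, zero_add, mul_one,
      mul_eq_zero] at hQ₃
    exact hQ₃.elim hP₁₃ hc₂3
  let F : 𝔏.Frame := ⟨a, d₁, c₂, y, hpa, hsa, hs₁, hsc₂, hyU, hQy, h1c₂, h1y, h2y, ho₁, hac₂, hay⟩
  have hle : F.plane ≤ A := by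
    rw [Frame.plane, Submodule.span_le]
    rintro _ (rfl | rfl | rfl)
    exacts [hp₁, hc₂A, hyA]
  have hplane : F.plane = A := Submodule.eq_of_le_of_finrank_eq hle ((F.finrank_plane h2).trans hA.symm)
  refine ⟨F, rfl, ?_⟩
  rw [hZ, ← hplane]
  rfl

end LaguerreSpace

/-! ### Recovering stars from pencils -/

section Star

variable {α : Type*} {β : Type*} (R : α → β → Prop)

/-- Two distinct elements lie in a common block. -/
def InCommonBlock (L M : α) : Prop := L ≠ M ∧ ∃ p, R L p ∧ R M p

/-- An element shares a block with at least two members of the block `p`. -/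
def NearBlock (p : β) (M : α) : Prop :=
  ∃ G G', G ≠ G' ∧ R G p ∧ R G' p ∧ InCommonBlock R M G ∧ InCommonBlock R M G'

/-- An element lies in a block at least two of whose members are near the block `p`. -/
def InStarOf (p : β) (L : α) : Prop :=
  ∃ q M M', M ≠ M' ∧ R L q ∧ R M q ∧ R M' q ∧ NearBlock R p M ∧ NearBlock R p M'

end Star

/-! ### Stars of points, and blocks of generators -/

namespace LaguerreSpace

variable {K : Type u} {V : Type v} [Field K] [AddCommGroup V] [Module K V] {𝔏 : LaguerreSpace K V}

theorem IsPair.projPts_ne {a c d : V} (hc : 𝔏.IsPair a c) (hcd : 𝔏.P c d ≠ 0) :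
    projPts (Submodule.span K {a, c}) ≠ projPts (Submodule.span K {a, d}) := by
  intro h
  have hd : d ∈ Submodule.span K {a, c} := by
    rw [projPts_injective h]
    exact Submodule.subset_span (by simp)
  obtain ⟨s, t, rfl⟩ := Submodule.mem_span_pair.1 hd
  simp [𝔏.P_comm c a, hc.ortho, hc.sing_right.P_self] at hcd

theorem Frame.exists_isGen_ne (F : 𝔏.Frame) (h2 : (2 : K) ≠ 0) :
    ∃ L L', F.IsGen L ∧ F.IsGen L' ∧ L ≠ L' := by
  have h : 𝔏.P F.c₁ F.c₂ ≠ 0 := by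
    rw [F.P_c₁_c₂]
    exact one_ne_zero
  have h₁ : F.c₁ ≠ 0 := fun h0 => h (by simp [h0])
  have h₂ : F.c₂ ≠ 0 := fun h0 => h (by simp [h0])
  exact ⟨_, _, ⟨_, F.c₁_mem, h₁, F.sing_c₁.2, rfl⟩, ⟨_, F.c₂_mem, h₂, F.sing_c₂.2, rfl⟩,
    (F.isPair h2 F.c₁_mem h₁ F.sing_c₁.2).projPts_ne h⟩

/-- The projective lines through the vertex of a projective cone are those that are adjacent or
equal to each of its lines. -/
theorem Frame.star_eq (F : 𝔏.Frame) (h2 : (2 : K) ≠ 0) :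
    𝔏.star F.vertex ∩ 𝔏.projLines = {L | L ∈ 𝔏.projLines ∧
      ∀ L' ∈ 𝔏.projLines, L' ⊆ F.cone → 𝔏.Adjacent L L' ∨ L = L'} := by
  ext L
  constructor
  · rintro ⟨⟨-, hv⟩, hL⟩
    refine ⟨hL, fun L' hL' hL'F => ?_⟩
    have := ((F.subset_cone_iff h2 hL').1 hL'F).vertex_mem
    exact (ne_or_eq L L').imp_left fun h => ⟨h, F.vertex, F.vertex_mem_S, hv, this⟩
  · rintro ⟨hL, h⟩
    have hmeet : ∀ M, F.IsGen M → ∃ p, p ∈ M ∧ p ∈ L := fun M hM => by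
      rcases h M (hM.mem_projLines h2) (hM.subset_cone h2) with ⟨-, p, -, hp, hp'⟩ | rfl
      · exact ⟨p, hp', hp⟩
      · exact ⟨F.vertex, hM.vertex_mem, hM.vertex_mem⟩
    -- Meeting two generators is already enough.
    obtain ⟨M, M', hM, hM', hne⟩ := F.exists_isGen_ne h2
    exact ⟨⟨projLines_subset_lines hL,
      F.vertex_mem_of_meets h2 hM hM' hne hL (hmeet M hM) (hmeet M' hM')⟩, hL⟩

theorem stars_eq [FiniteDimensional K V] (h2 : (2 : K) ≠ 0) (hB : 5 ≤ Module.finrank K 𝔏.B) :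
    {s : Set (Set (ℙ K V)) | ∃ a ∈ 𝔏.S, s = 𝔏.star a ∩ 𝔏.projLines} =
      {s : Set (Set (ℙ K V)) | ∃ Z ∈ 𝔏.projCones, s = {L | L ∈ 𝔏.projLines ∧
        ∀ L' ∈ 𝔏.projLines, L' ⊆ Z → 𝔏.Adjacent L L' ∨ L = L'}} := by
  ext s
  constructor
  · rintro ⟨a, ha, rfl⟩
    obtain ⟨F, rfl⟩ := exists_frame_of_mem_S hB ha
    exact ⟨F.cone, ⟨F.vertex, F.isProjConeAt h2⟩, F.star_eq h2⟩
  · rintro ⟨Z, ⟨p, hZ⟩, rfl⟩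
    obtain ⟨F, rfl, rfl⟩ := exists_frame_of_isProjConeAt h2 hZ
    exact ⟨F.vertex, F.vertex_mem_S, (F.star_eq h2).symm⟩

/-- The blocks of an incidence relation on the projective lines are the sets of generators of the
projective cones. -/
structure BlocksAreCones {β : Type*} (R : 𝔏.projLines → β → Prop) : Prop where
  exists_frame : ∀ p, ∃ F : 𝔏.Frame, ∀ L, R L p ↔ F.IsGen L
  exists_block : ∀ F : 𝔏.Frame, ∃ p, ∀ L, R L p ↔ F.IsGen L

namespace BlocksAreCones

variable {β : Type*} {R : 𝔏.projLines → β → Prop}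

theorem exists_common_point (hR : BlocksAreCones R) {L M : 𝔏.projLines}
    (h : InCommonBlock R L M) : ∃ p, p ∈ (M : Set (ℙ K V)) ∧ p ∈ (L : Set (ℙ K V)) := by
  obtain ⟨-, p, hL, hM⟩ := h
  obtain ⟨F, hF⟩ := hR.exists_frame p
  exact ⟨F.vertex, ((hF _).1 hM).vertex_mem, ((hF _).1 hL).vertex_mem⟩

theorem vertex_mem_of_nearBlock (hR : BlocksAreCones R) (h2 : (2 : K) ≠ 0) {p : β} {F : 𝔏.Frame}
    (hF : ∀ L, R L p ↔ F.IsGen L) {M : 𝔏.projLines} (h : NearBlock R p M) :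
    F.vertex ∈ (M : Set (ℙ K V)) := by
  obtain ⟨G, G', hne, hG, hG', hMG, hMG'⟩ := h
  exact F.vertex_mem_of_meets h2 ((hF G).1 hG) ((hF G').1 hG') (Subtype.coe_injective.ne hne) M.2
    (hR.exists_common_point hMG) (hR.exists_common_point hMG')

theorem inCommonBlock (hR : BlocksAreCones R) [FiniteDimensional K V]
    (hB : 5 ≤ Module.finrank K 𝔏.B) {a x y : V} (hx : 𝔏.IsPair a x) (hy : 𝔏.IsPair a y)
    (hxy : 𝔏.P x y ≠ 0) : InCommonBlock R ⟨_, hx.projPts_mem⟩ ⟨_, hy.projPts_mem⟩ := by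
  obtain ⟨F, -, hFx, hFy⟩ := exists_frame_isGen hB hx hy hxy
  obtain ⟨p, hp⟩ := hR.exists_block F
  exact ⟨fun h => hx.projPts_ne hxy (congrArg Subtype.val h), p, (hp _).2 hFx, (hp _).2 hFy⟩

/-- The functional P(m, ·) is nonzero at two points of the conic, and the generators through them
are nonorthogonal to the line ⟨a, m⟩. -/
theorem nearBlock (hR : BlocksAreCones R) [FiniteDimensional K V] (h2 : (2 : K) ≠ 0)
    (hB : 5 ≤ Module.finrank K 𝔏.B) {p : β} {F : 𝔏.Frame} (hF : ∀ L, R L p ↔ F.IsGen L) {m z : V}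
    (hm : 𝔏.IsPair F.a m) (hz : z ∈ F.plane) (hmz : 𝔏.P m z ≠ 0) :
    NearBlock R p ⟨_, hm.projPts_mem⟩ := by
  obtain ⟨c, hc, d, hd, hQc, hQd, hcd, hmc, hmd⟩ := F.exists_two_nonorthogonal h2 hz hmz
  have hc0 : c ≠ 0 := fun h => hmc (by simp [h])
  have hd0 : d ≠ 0 := fun h => hmd (by simp [h])
  have hac := F.isPair h2 hc hc0 hQc
  have had := F.isPair h2 hd hd0 hQd
  exact ⟨⟨_, hac.projPts_mem⟩, ⟨_, had.projPts_mem⟩,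
    fun h => hac.projPts_ne hcd (congrArg Subtype.val h), (hF _).2 ⟨c, hc, hc0, hQc, rfl⟩,
    (hF _).2 ⟨d, hd, hd0, hQd, rfl⟩, hR.inCommonBlock hB hm hac hmc, hR.inCommonBlock hB hm had hmd⟩

theorem inStarOf_iff (hR : BlocksAreCones R) [FiniteDimensional K V] (h2 : (2 : K) ≠ 0)
    (hB : 5 ≤ Module.finrank K 𝔏.B) {p : β} {F : 𝔏.Frame} (hF : ∀ L, R L p ↔ F.IsGen L)
    (L : 𝔏.projLines) : InStarOf R p L ↔ F.vertex ∈ (L : Set (ℙ K V)) := by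
  constructor
  · rintro ⟨q, M, M', hne, hL, hM, hM', hnM, hnM'⟩
    obtain ⟨G, hG⟩ := hR.exists_frame q
    -- M and M' are distinct and both pass through both vertices, so the vertices coincide.
    rw [eq_of_mem_of_mem M.2 M'.2 (Subtype.coe_injective.ne hne)
      (hR.vertex_mem_of_nearBlock h2 hF hnM) (hR.vertex_mem_of_nearBlock h2 hF hnM')
      ((hG _).1 hM).vertex_mem ((hG _).1 hM').vertex_mem]
    exact ((hG _).1 hL).vertex_mem
  · obtain ⟨L, hL⟩ := L
    intro hv
    obtain ⟨x, hx, rfl⟩ := exists_isPair_of_mem hL F.a_ne_zero hv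
    obtain ⟨y, hy, hxy, z, hz, hzxy⟩ : ∃ y, 𝔏.IsPair F.a y ∧ 𝔏.P x y = 1 ∧
        ∃ z ∈ F.plane, 𝔏.P z x ≠ 0 ∨ 𝔏.P z y ≠ 0 := by
      obtain ⟨y, hy, hxy⟩ := hx.exists_partner
      by_cases h₁ : 𝔏.P F.c₁ x = 0
      swap
      · exact ⟨y, hy, hxy, F.c₁, F.c₁_mem, Or.inl h₁⟩
      by_cases h₂ : 𝔏.P F.c₁ y = 0
      swap
      · exact ⟨y, hy, hxy, F.c₁, F.c₁_mem, Or.inr h₂⟩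
      by_cases h₃ : 𝔏.P F.c₂ y = 0
      swap
      · exact ⟨y, hy, hxy, F.c₂, F.c₂_mem, Or.inr h₃⟩
      -- Here c₁ is orthogonal to x and y, so adding it to y keeps y singular and its product with x
      -- equal to one, while the product with c₂ changes from 0 to 1.
      have hxy' : 𝔏.P x (y + F.c₁) = 1 := by rw [map_add, hxy, 𝔏.P_comm x, h₁, add_zero]
      refine ⟨y + F.c₁, IsPair.of_separated (w := x) F.sing_a ?_ ?_ F.proj_a hx.ortho ?_, hxy',
        F.c₂, F.c₂_mem, Or.inr ?_⟩
      · have := hy.sing_right.combination F.sing_c₁ (by rw [P_comm, h₂]) 1 1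
        rwa [one_smul, one_smul] at this
      · rw [map_add, hy.ortho, F.P_a_c₁, add_zero]
      · rw [P_comm, hxy']
        exact one_ne_zero
      · rw [map_add, h₃, F.P_c₂_c₁, zero_add]
        exact one_ne_zero
    -- L is a generator of a second cone with the same vertex, whose plane is not orthogonal to z.
    -- Two of its generators are then nonorthogonal to z, hence near p.
    obtain ⟨G, hGa, rfl, rfl⟩ := LaguerreSpace.exists_frame hB hx hy hxy
    obtain ⟨q, hq⟩ := hR.exists_block G
    obtain ⟨w, hw, hzw⟩ : ∃ w ∈ G.plane, 𝔏.P z w ≠ 0 :=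
      hzxy.elim (fun h => ⟨_, G.c₁_mem, h⟩) fun h => ⟨_, G.c₂_mem, h⟩
    obtain ⟨m, hm, n, hn, hQm, hQn, hmn, hzm, hzn⟩ := G.exists_two_nonorthogonal h2 hw hzw
    have hm0 : m ≠ 0 := fun h => hzm (by simp [h])
    have hn0 : n ≠ 0 := fun h => hzn (by simp [h])
    have ham := G.isPair h2 hm hm0 hQm
    have han := G.isPair h2 hn hn0 hQn
    rw [hGa] at ham han
    exact ⟨q, ⟨_, ham.projPts_mem⟩, ⟨_, han.projPts_mem⟩,
      fun h => ham.projPts_ne hmn (congrArg Subtype.val h),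
      (hq _).2 ⟨_, G.c₁_mem, hx.right_ne_zero, G.sing_c₁.2, by rw [hGa]⟩,
      (hq _).2 ⟨m, hm, hm0, hQm, by rw [hGa]⟩, (hq _).2 ⟨n, hn, hn0, hQn, by rw [hGa]⟩,
      hR.nearBlock h2 hB hF ham hz (by rwa [P_comm]),
      hR.nearBlock h2 hB hF han hz (by rwa [P_comm])⟩

end BlocksAreCones

theorem blocksAreCones_cones (h2 : (2 : K) ≠ 0) :
    BlocksAreCones fun (L : 𝔏.projLines) (Z : 𝔏.projCones) => (L : Set (ℙ K V)) ⊆ Z where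
  exists_frame := by
    rintro ⟨Z, p, hZ⟩
    obtain ⟨F, rfl, rfl⟩ := exists_frame_of_isProjConeAt h2 hZ
    exact ⟨F, fun L => F.subset_cone_iff h2 L.2⟩
  exists_block F := ⟨⟨F.cone, F.vertex, F.isProjConeAt h2⟩, fun L => F.subset_cone_iff h2 L.2⟩

theorem blocksAreCones_pencils (h2 : (2 : K) ≠ 0) :
    BlocksAreCones fun (L : 𝔏.projLines) (p : 𝔏.conicPencils) =>
      (L : Set (ℙ K V)) ∈ (p : Set (Set (ℙ K V))) := by
  have h : ∀ (F : 𝔏.Frame) (L : 𝔏.projLines), (L : Set (ℙ K V)) ∈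
      {L | L ∈ 𝔏.lines ∧ F.vertex ∈ L ∧ L ⊆ F.cone} ↔ F.IsGen L := fun F L =>
    ⟨fun h => F.isGen_of_subset_cone h2 L.2 h.2.2,
      fun h => ⟨projLines_subset_lines L.2, h.vertex_mem, h.subset_cone h2⟩⟩
  constructor
  · rintro ⟨_, Z, p, hZ, rfl⟩
    obtain ⟨F, rfl, rfl⟩ := exists_frame_of_isProjConeAt h2 hZ
    exact ⟨F, h F⟩
  · exact fun F => ⟨⟨_, F.cone, F.vertex, F.isProjConeAt h2, rfl⟩, h F⟩

/-- A point is determined by the projective lines through it. -/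
theorem eq_of_mem_projLines_iff [FiniteDimensional K V] (h2 : (2 : K) ≠ 0)
    (hB : 5 ≤ Module.finrank K 𝔏.B) {p q : ℙ K V} (hp : p ∈ 𝔏.S)
    (h : ∀ L ∈ 𝔏.projLines, p ∈ L → q ∈ L) : p = q := by
  obtain ⟨F, rfl⟩ := exists_frame_of_mem_S hB hp
  obtain ⟨L, L', hL, hL', hne⟩ := F.exists_isGen_ne h2
  have hLp := hL.mem_projLines h2
  have hLp' := hL'.mem_projLines h2
  exact eq_of_mem_of_mem hLp hLp' hne hL.vertex_mem hL'.vertex_mem (h L hLp hL.vertex_mem)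
    (h L' hLp' hL'.vertex_mem)

end LaguerreSpace

/-! ### The interpretation -/

section Interpretation

open FirstOrder.Language

/-- The atomic formula saying that the value of a variable is of the first sort. -/
def fstFormula {ι : Type} (i : ι) : incLang.Formula ι :=
  Relations.formula₁ (show incLang.Relations 1 from IncRel.fst) (Term.var i)

/-- The atomic formula saying that the value of a variable is of the second sort. -/
def sndFormula {ι : Type} (i : ι) : incLang.Formula ι :=
  Relations.formula₁ (show incLang.Relations 1 from IncRel.snd) (Term.var i)

/-- The atomic formula saying that the values of two variables are incident. -/
def incFormula {ι : Type} (i j : ι) : incLang.Formula ι :=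
  Relations.formula₂ (show incLang.Relations 2 from IncRel.inc) (Term.var i) (Term.var j)

/-- The formula for `InCommonBlock`. -/
noncomputable def commonBlockFormula : incLang.Formula (Fin 2) :=
  ((Term.var 0).equal (Term.var 1)).not ⊓
    Formula.iExs (Fin 1) (incFormula (Sum.inl 0) (Sum.inr 0) ⊓ incFormula (Sum.inl 1) (Sum.inr 0))

/-- The formula for `NearBlock`. -/
noncomputable def nearBlockFormula : incLang.Formula (Fin 2) :=
  Formula.iExs (Fin 2) (((Term.var (Sum.inr 0)).equal (Term.var (Sum.inr 1))).not ⊓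
    (incFormula (Sum.inr 0) (Sum.inl 0) ⊓ (incFormula (Sum.inr 1) (Sum.inl 0) ⊓
      (commonBlockFormula.relabel ![Sum.inl 1, Sum.inr 0] ⊓
        commonBlockFormula.relabel ![Sum.inl 1, Sum.inr 1]))))

/-- The formula for `InStarOf`. -/
noncomputable def inStarFormula : incLang.Formula (Fin 2) :=
  Formula.iExs (Fin 3) (((Term.var (Sum.inr 1)).equal (Term.var (Sum.inr 2))).not ⊓
    (incFormula (Sum.inl 1) (Sum.inr 0) ⊓ (incFormula (Sum.inr 1) (Sum.inr 0) ⊓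
      (incFormula (Sum.inr 2) (Sum.inr 0) ⊓
        (nearBlockFormula.relabel ![Sum.inl 0, Sum.inr 1] ⊓
          nearBlockFormula.relabel ![Sum.inl 0, Sum.inr 2])))))

/-- The interpretation whose points are the blocks modulo equality of stars. -/
noncomputable def starInterpretation : IncInterpretation where
  dom := ⊤
  -- Plain equality is what identifies lines; stars compare only blocks.
  eqv := (Term.var 0).equal (Term.var 1) ⊔
    (sndFormula 0 ⊓
      (sndFormula 1 ⊓
        Formula.iAlls (Fin 1) ((inStarFormula.relabel ![Sum.inl 0, Sum.inr 0]).iff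
          (inStarFormula.relabel ![Sum.inl 1, Sum.inr 0]))))
  rel := fun _ r => match r with
    | .fst => sndFormula 0
    | .snd => fstFormula 0
    | .inc => inStarFormula

/-! ### Meaning of the formulas in an incidence structure -/

variable {α β : Type v} {R : α → β → Prop}

theorem realize_incFormula {ι : Type} {i j : ι} {x : ι → IncStr R} :
    (incFormula i j).Realize x ↔
      ∃ a b, x i = ⟨Sum.inl a⟩ ∧ x j = ⟨Sum.inr b⟩ ∧ R a b := by
  refine Formula.realize_rel₂.trans ?_
  constructor
  · rintro ⟨a, b, ha, hb, h⟩
    exact ⟨a, b, congrArg IncStr.mk ha, congrArg IncStr.mk hb, h⟩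
  · rintro ⟨a, b, ha, hb, h⟩
    exact ⟨a, b, congrArg IncStr.val ha, congrArg IncStr.val hb, h⟩

/-- The formulas carry no explicit sort conditions: incidence atoms hold only between elements of
the right sorts. -/
theorem realize_commonBlockFormula {x : Fin 2 → IncStr R} :
    commonBlockFormula.Realize x ↔
      ∃ L M, x 0 = ⟨Sum.inl L⟩ ∧ x 1 = ⟨Sum.inl M⟩ ∧ InCommonBlock R L M := by
  simp only [commonBlockFormula, Formula.realize_inf, Formula.realize_not, Formula.realize_equal,
    Formula.realize_iExs, realize_incFormula, Term.realize_var, Sum.elim_inl, Sum.elim_inr]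
  constructor
  · rintro ⟨hne, i, ⟨L, p, hL, hp, h⟩, M, q, hM, hq, h'⟩
    rw [hp, IncStr.mk.injEq, Sum.inr.injEq] at hq
    subst hq
    refine ⟨L, M, hL, hM, ?_, p, h, h'⟩
    rintro rfl
    exact hne (hL.trans hM.symm)
  · rintro ⟨L, M, hL, hM, hne, p, h, h'⟩
    refine ⟨?_, fun _ => ⟨Sum.inr p⟩, ⟨L, p, hL, rfl, h⟩, M, p, hM, rfl, h'⟩
    rw [hL, hM, IncStr.mk.injEq, Sum.inl.injEq]
    exact hne

theorem realize_nearBlockFormula {x : Fin 2 → IncStr R} :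
    nearBlockFormula.Realize x ↔
      ∃ p M, x 0 = ⟨Sum.inr p⟩ ∧ x 1 = ⟨Sum.inl M⟩ ∧ NearBlock R p M := by
  simp only [nearBlockFormula, Formula.realize_inf, Formula.realize_not, Formula.realize_equal,
    Formula.realize_iExs, realize_incFormula, Term.realize_var, Sum.elim_inl, Sum.elim_inr,
    Formula.realize_relabel, realize_commonBlockFormula, Function.comp_apply, Matrix.cons_val_zero,
    Matrix.cons_val_one]
  constructor
  · rintro ⟨i, hne, ⟨G, p, hG, hp, h⟩, ⟨G', p', hG', hp', h'⟩, ⟨M, N, hM, hN, hMN⟩,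
      M', N', hM', hN', hMN'⟩
    rw [hp, IncStr.mk.injEq, Sum.inr.injEq] at hp'
    rw [hM, IncStr.mk.injEq, Sum.inl.injEq] at hM'
    rw [hG, IncStr.mk.injEq, Sum.inl.injEq] at hN
    rw [hG', IncStr.mk.injEq, Sum.inl.injEq] at hN'
    subst hp' hM' hN hN'
    refine ⟨p, M, hp, hM, G, G', ?_, h, h', hMN, hMN'⟩
    rintro rfl
    exact hne (hG.trans hG'.symm)
  · rintro ⟨p, M, hp, hM, G, G', hne, h, h', hMG, hMG'⟩
    refine ⟨![⟨Sum.inl G⟩, ⟨Sum.inl G'⟩], ?_, ⟨G, p, rfl, hp, h⟩, ⟨G', p, rfl, hp, h'⟩,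
      ⟨M, G, hM, rfl, hMG⟩, M, G', hM, rfl, hMG'⟩
    simpa using hne

theorem realize_inStarFormula {x : Fin 2 → IncStr R} :
    inStarFormula.Realize x ↔
      ∃ p L, x 0 = ⟨Sum.inr p⟩ ∧ x 1 = ⟨Sum.inl L⟩ ∧ InStarOf R p L := by
  simp only [inStarFormula, Formula.realize_inf, Formula.realize_not, Formula.realize_equal,
    Formula.realize_iExs, realize_incFormula, Term.realize_var, Sum.elim_inl, Sum.elim_inr,
    Formula.realize_relabel, realize_nearBlockFormula, Function.comp_apply, Matrix.cons_val_zero,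
    Matrix.cons_val_one]
  constructor
  · rintro ⟨i, hne, ⟨L, q, hL, hq, hLq⟩, ⟨M, q₁, hM, hq₁, hMq⟩, ⟨M', q₂, hM', hq₂, hMq'⟩,
      ⟨p, N, hp, hN, hpN⟩, p', N', hp', hN', hpN'⟩
    rw [hq, IncStr.mk.injEq, Sum.inr.injEq] at hq₁ hq₂
    rw [hp, IncStr.mk.injEq, Sum.inr.injEq] at hp'
    rw [hM, IncStr.mk.injEq, Sum.inl.injEq] at hN
    rw [hM', IncStr.mk.injEq, Sum.inl.injEq] at hN'
    subst hq₁ hq₂ hp' hN hN'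
    refine ⟨p, L, hp, hL, q, M, M', ?_, hLq, hMq, hMq', hpN, hpN'⟩
    rintro rfl
    exact hne (hM.trans hM'.symm)
  · rintro ⟨p, L, hp, hL, q, M, M', hne, hLq, hMq, hMq', hpM, hpM'⟩
    refine ⟨![⟨Sum.inr q⟩, ⟨Sum.inl M⟩, ⟨Sum.inl M'⟩], ?_, ⟨L, q, hL, rfl, hLq⟩,
      ⟨M, q, rfl, rfl, hMq⟩, ⟨M', q, rfl, rfl, hMq'⟩, ⟨p, M, hp, rfl, hpM⟩, p, M', hp, rfl, hpM'⟩
    simpa using hne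

theorem realize_fstFormula {ι : Type} {i : ι} {x : ι → IncStr R} :
    (fstFormula i).Realize x ↔ ∃ a, (x i).val = Sum.inl a :=
  Formula.realize_rel₁

theorem realize_sndFormula {ι : Type} {i : ι} {x : ι → IncStr R} :
    (sndFormula i).Realize x ↔ ∃ b, (x i).val = Sum.inr b :=
  Formula.realize_rel₁

/-- If `InStarOf` describes the incidence of the vertices of the blocks, then the interpretation
defines the geometry of these vertices. -/
theorem starInterpretation_defines {γ : Type v} {S : γ → α → Prop} (vertex : β → γ)
    (hsurj : Function.Surjective vertex) (hstar : ∀ p L, InStarOf R p L ↔ S (vertex p) L)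
    (hext : ∀ a b, (∀ L, S a L ↔ S b L) → a = b) :
    ∃ f, starInterpretation.Defines (IncStr R) (IncStr S) f ∧
      ∀ L, ∃ h, f ⟨⟨Sum.inl L⟩, h⟩ = ⟨Sum.inr L⟩ := by
  have hdom : ∀ x : IncStr R, starInterpretation.dom.Realize ![x] := fun x => Formula.realize_top.2 trivial
  let g : IncStr R → IncStr S := fun x => ⟨x.val.elim Sum.inr fun p => Sum.inl (vertex p)⟩
  refine ⟨fun x => g x, ⟨?_, ?_, ?_⟩, fun L => ⟨hdom _, rfl⟩⟩
  · rintro ⟨a | L⟩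
    · obtain ⟨p, rfl⟩ := hsurj a
      exact ⟨⟨⟨Sum.inr p⟩, hdom _⟩, rfl⟩
    · exact ⟨⟨⟨Sum.inl L⟩, hdom _⟩, rfl⟩
  · rintro ⟨x, -⟩ ⟨y, -⟩
    simp only [starInterpretation, Formula.realize_sup, Formula.realize_inf, Formula.realize_equal,
      realize_sndFormula, Formula.realize_iAlls, Formula.realize_iff, Formula.realize_relabel,
      realize_inStarFormula, Term.realize_var, Function.comp_apply, Matrix.cons_val_zero,
      Matrix.cons_val_one, Sum.elim_inl, Sum.elim_inr]
    obtain ⟨L | p⟩ := x <;> obtain ⟨M | q⟩ := y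
    · simp [g]
    · simp [g]
    · simp [g]
    · simp only [g, Sum.elim_inr, IncStr.mk.injEq, Sum.inl.injEq, Sum.inr.injEq]
      constructor
      · rintro (rfl | ⟨-, -, h⟩)
        · rfl
        · refine hext _ _ fun L => ?_
          rw [← hstar, ← hstar]
          simpa using h fun _ => ⟨Sum.inl L⟩
      · intro h
        refine Or.inr ⟨⟨p, rfl⟩, ⟨q, rfl⟩, fun i => ?_⟩
        simp [hstar, h]
  · rintro n (_ | _ | _) xs
    · refine realize_sndFormula.trans ?_
      change _ ↔ ∃ a, (g (xs 0)).val = Sum.inl a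
      obtain ⟨⟨L | p⟩, -⟩ := xs 0 <;> simp [g]
    · refine realize_fstFormula.trans ?_
      change _ ↔ ∃ a, (g (xs 0)).val = Sum.inr a
      obtain ⟨⟨L | p⟩, -⟩ := xs 0 <;> simp [g]
    · refine realize_inStarFormula.trans ?_
      change _ ↔ ∃ a b, (g (xs 0)).val = Sum.inl a ∧ (g (xs 1)).val = Sum.inr b ∧ S a b
      obtain ⟨⟨L | p⟩, -⟩ := xs 0 <;> obtain ⟨⟨M | q⟩, -⟩ := xs 1 <;> simp [g, hstar]

end Interpretation

/-! ### Defining the point-line geometry from blocks -/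

namespace LaguerreSpace

theorem BlocksAreCones.exists_defines {K : Type u} {V : Type v} [Field K] [AddCommGroup V] [Module K V]
    [FiniteDimensional K V] {𝔏 : LaguerreSpace K V} (h2 : (2 : K) ≠ 0)
    (hB : 5 ≤ Module.finrank K 𝔏.B) {β : Type v} {R : 𝔏.projLines → β → Prop}
    (hR : BlocksAreCones R) :
    ∃ f, starInterpretation.Defines (IncStr R) 𝔏.PointLineStructure f ∧
      ∀ L : 𝔏.projLines, ∃ h, f ⟨⟨Sum.inl L⟩, h⟩ = ⟨Sum.inr L⟩ := by
  choose F hF using hR.exists_frame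
  have hstar := fun p L => hR.inStarOf_iff h2 hB (hF p) L
  refine starInterpretation_defines (fun p => (⟨(F p).vertex, (F p).vertex_mem_S⟩ : 𝔏.S)) ?_ hstar
    fun a b h => Subtype.ext (eq_of_mem_projLines_iff h2 hB a.2 fun L hL => (h ⟨L, hL⟩).1)
  rintro ⟨a, ha⟩
  obtain ⟨G, rfl⟩ := exists_frame_of_mem_S hB ha
  obtain ⟨p, hp⟩ := hR.exists_block G
  -- The frame chosen for p may differ from G, but both describe `InStarOf` for p, so their vertices
  -- lie on the same lines.
  refine ⟨p, Subtype.ext (eq_of_mem_projLines_iff h2 hB (F p).vertex_mem_S fun L hL h => ?_)⟩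
  exact (hR.inStarOf_iff h2 hB hp ⟨L, hL⟩).1 ((hstar p ⟨L, hL⟩).2 h)

end LaguerreSpace

theorem mainTheorem1 :
    ∃ I : IncInterpretation,
      ∀ (K : Type u) (V : Type v) [Field K] [AddCommGroup V] [Module K V]
        [FiniteDimensional K V] (_h2 : (2 : K) ≠ 0) (𝔏 : LaguerreSpace K V) (_hnu : 3 ≤ 𝔏.nu),
        -- the stars of projective lines, characterized through adjacency and projective cones
        {s : Set (Set (ℙ K V)) | ∃ a ∈ 𝔏.S, s = 𝔏.star a ∩ 𝔏.projLines} =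
          {s : Set (Set (ℙ K V)) | ∃ Z ∈ 𝔏.projCones,
            s = {L | L ∈ 𝔏.projLines ∧
              ∀ L' ∈ 𝔏.projLines, L' ⊆ Z → 𝔏.Adjacent L L' ∨ L = L'}} ∧
        -- the point-line geometry is definable in the structure of lines and cones,
        -- with each projective line represented by itself
        (∃ f, I.Defines 𝔏.ConeStructure 𝔏.PointLineStructure f ∧
          ∀ L : 𝔏.projLines, ∃ h, f ⟨⟨Sum.inl L⟩, h⟩ = ⟨Sum.inr L⟩) ∧
        -- and, by the same formulas, in the structure of lines and conic pencils
        (∃ f, I.Defines 𝔏.PencilStructure 𝔏.PointLineStructure f ∧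
          ∀ L : 𝔏.projLines, ∃ h, f ⟨⟨Sum.inl L⟩, h⟩ = ⟨Sum.inr L⟩) := by
  refine ⟨starInterpretation, fun K V _ _ _ _ h2 𝔏 hnu => ?_⟩
  -- The subtraction in `nu` is truncated, which is harmless as the difference is at least 3.
  have hB : 5 ≤ Module.finrank K 𝔏.B := by
    rw [LaguerreSpace.nu] at hnu
    omega
  exact ⟨LaguerreSpace.stars_eq h2 hB, (LaguerreSpace.blocksAreCones_cones h2).exists_defines h2 hB,
    (LaguerreSpace.blocksAreCones_pencils h2).exists_defines h2 hB⟩
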